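/- Let $g:\mathbb R\to\mathbb C$ satisfy the Hölder condition on the extended real line: $|g(x)-g(y)|\le C|x-y|^{\alpha}$ for all $x,y\in\mathbb R$, and $|g(x)-L|\le C'|1/x|^{\beta}$ for $|x|\ge 1$, for some constants $C,C'\ge 0$, $\alpha,\beta>0$ and $L\in\mathbb C$. Suppose that $g(0)=1$ and that $g$ has index zero, i.e. the closed curve $g(\mathbb R\cup\{\infty\})$, with $g(\infty)=L$, avoids the origin and has winding number $0$ about it. Let $\ln g$ be the continuous branch of the logarithm of $g$ on $\mathbb R$ with $\ln g(0)=0$ (the real logarithm if $g>0$), and put $\sqrt g=e^{(\ln g)/2}$. For $s=\ln g$ define $$\phi_{s}(\lambda)=\frac1{2\pi i}\,\mathrm{p.v.}\!\int_{\mathbb R}\frac{s(x)}{x-\lambda}\,dx\quad(\lambda\in\mathbb C),\qquad H_{s}(\omega)=\frac1{\pi}\,\mathrm{p.v.}\!\int_{\mathbb R}\frac{s(x)}{x-\omega}\,dx\quad(\omega\in\mathbb R),$$ where the principal value is the limit of the integrals over $\{|x|<R,\ |x-\lambda|>\varepsilon\}$ as $R\to\infty$ and $\varepsilon\to0^+$.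 A solution of $\Phi^+\Phi^-=g$ is a function $\Phi$ that is analytic and bounded on $\mathbb C\setminus\mathbb R$, whose modulus is bounded away from zero in at least one of the two open half-planes, and whose radial limits $\Phi^\pm(\omega)=\lim_{y\to0^\pm}\Phi(\omega+iy)$ exist for all $\omega\in\mathbb R$ and satisfy $\Phi^+(\omega)\Phi^-(\omega)=g(\omega)$; write $\Phi^\pm$ also for the restrictions of $\Phi$ to the open upper and lower half-planes. Then $\phi_{\ln g}(\lambda)$ exists for every $\lambda\in\mathbb C$, and there is exactly one solution with $\Phi^+(0)=1$; it is given by $$\Phi^\pm(\lambda)=\exp\{\pm(\phi_{\ln g}(\lambda)-\phi_{\ln g}(0))\}\qquad(\pm\operatorname{Im}\lambda>0),$$ and on the real line $$\Phi^\pm(\omega)=\sqrt{g(\omega)}\,\exp\Big\{\pm\frac i2\big(H_{\ln g}(0)-H_{\ln g}(\omega)\big)\Big\}\qquad(\omega\in\mathbb R).$$ Every other solution is obtained from this one by replacing $(\Phi^+,\Phi^-)$ with $(c\,\Phi^+,c^{-1}\Phi^-)$, where $c=\Phi^+(0)\ne0$ is the value for that other solution. -/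

import Mathlib

open Filter Topology Complex
open scoped NNReal

namespace WienerHopf

/-- Hölder condition on the extended real line: `g` is Hölder continuous on `ℝ`, and it is Hölder
at the point at infinity, where distances are measured in the coordinate `1 / x`. -/
def HolderOnExtendedLine (g : ℝ → ℂ) : Prop :=
  (∃ C α : ℝ≥0, 0 < α ∧ HolderWith C α g) ∧
    ∃ (L : ℂ) (C α : ℝ), 0 < α ∧ ∀ x : ℝ, 1 ≤ |x| → ‖g x - L‖ ≤ C * |1 / x| ^ α

/-- The closed curve traced out by `g` on the extended real line does not meet the origin and has
winding number `n` about it: along the line, a continuous logarithm of `g`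
increases by `2 π i n`. -/
def HasIndex (g : ℝ → ℂ) (n : ℤ) : Prop :=
  ∃ s : ℝ → ℂ, Continuous s ∧ (∀ x, exp (s x) = g x) ∧
    ∃ a b : ℂ, Tendsto s atBot (𝓝 a) ∧ Tendsto s atTop (𝓝 b) ∧ b - a = 2 * Real.pi * I * n

/-- `s` is the continuous branch of `ln g` that vanishes at the origin.  It is unique; for a
positive function `g` with `g 0 = 1` it is the usual real logarithm of `g`. -/
structure IsLogBranch (g s : ℝ → ℂ) : Prop where
  continuous : Continuous s
  exp_eq : ∀ x, exp (s x) = g x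
  zero : s 0 = 0

/-- The truncated integral `∫ f(x) dx` over `|x| < R`, `|x - c| > ε`, for `p = (ε, R)`. -/
noncomputable def truncatedIntegral (f : ℝ → ℂ) (c : ℂ) (p : ℝ × ℝ) : ℂ :=
  ∫ x in {x : ℝ | p.1 < ‖(x : ℂ) - c‖ ∧ |x| < p.2}, f x

/-- The principal value integral of `f` over `ℝ`, with possible singularities at `c` and at
infinity, exists and equals `J`. For non-real `c` only the truncation at infinity matters. -/
def HasPV (f : ℝ → ℂ) (c J : ℂ) : Prop :=
  Tendsto (truncatedIntegral f c) (𝓝[>] (0 : ℝ) ×ˢ atTop) (𝓝 J)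

/-- The value of the principal value integral (meaningful when it exists). -/
noncomputable def pvIntegral (f : ℝ → ℂ) (c : ℂ) : ℂ :=
  limUnder (𝓝[>] (0 : ℝ) ×ˢ atTop) (truncatedIntegral f c)

/-- The Sokhotskyi-Plemelj integral
`φ_s(z) = (1 / 2πi) p.v. ∫ s(x) / (x - z) dx`, for all complex `z`. -/
noncomputable def plemelj (s : ℝ → ℂ) (z : ℂ) : ℂ :=
  1 / (2 * Real.pi * I) * pvIntegral (fun x => s x / (x - z)) z

/-- The Hilbert transform `H_s(ω) = (1 / π) p.v. ∫ s(x) / (x - ω) dx`. -/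
noncomputable def hilbertTransform (s : ℝ → ℂ) (ω : ℝ) : ℂ :=
  1 / Real.pi * pvIntegral (fun x => s x / (x - ω)) ω

/-- `Φ` is a sectionally analytic solution, with upper and lower radial limits `Φp` and `Φm`, of
the multiplicative Wiener-Hopf factorization problem `Φp * Φm = g` on the real line. The values
of `Φ` at real points play no role. -/
structure IsSolution (g : ℝ → ℂ) (Φ : ℂ → ℂ) (Φp Φm : ℝ → ℂ) : Prop where
  analytic : AnalyticOn ℂ Φ {z | z.im ≠ 0}
  bounded : ∃ M : ℝ, ∀ z : ℂ, z.im ≠ 0 → ‖Φ z‖ ≤ M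
  upper_limit : ∀ ω : ℝ, Tendsto (fun y : ℝ => Φ (ω + y * I)) (𝓝[>] 0) (𝓝 (Φp ω))
  lower_limit : ∀ ω : ℝ, Tendsto (fun y : ℝ => Φ (ω + y * I)) (𝓝[<] 0) (𝓝 (Φm ω))
  factorization : ∀ ω : ℝ, Φp ω * Φm ω = g ω
  /-- In at least one of the half-planes, `1 / Φ` is a bounded analytic function as well. This
  excludes spurious factors such as `(z - i) / (z + i)` or `exp (i z)` in the upper half-plane,
  compensated by their inverses in the lower one. -/
  bounded_inv : ∃ δ : ℝ, 0 < δ ∧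
    ((∀ z : ℂ, 0 < z.im → δ ≤ ‖Φ z‖) ∨ (∀ z : ℂ, z.im < 0 → δ ≤ ‖Φ z‖))

end WienerHopf

namespace WienerHopf

open MeasureTheory

/-! ### The Poisson kernel -/

/-! Write `ln g = L + u`. Index zero gives the logarithm the same limit `L` at both ends of the
line, and because `exp` is locally bi-Lipschitz, `u` inherits Hölder continuity and power decay from
`g` (`IsLogBranch.exists_holderDecay`).

For `z = ω + iy` the Cauchy integral of `L + u` splits into three pieces. The constant `L`
contributes `iπ L sign y` by symmetry of the truncation. The function `u - u(ω)`, with `u(ω)`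
subtracted only on the unit ball about `ω`, gives an absolutely convergent integral with a majorant
independent of `y`, so it is continuous as `y → 0`. The subtracted constant contributes `i u(ω)`
times a Poisson mass that tends to `±π` as `y → 0±` and is `0` at `y = 0`. Hence the principal value
exists everywhere, is bounded uniformly in `z`, and obeys the jump relations `φ± = φ ± (ln g)/2`.
Exponentiating gives `upperFactor`, bounded above and away from zero, and the two boundary factors
multiply to `g`.

For uniqueness, a solution is compared with the explicit one. The hypothesis on the modulus allows
division by `Φ` in one half-plane, so suitable quotients are bounded, analytic, and share their
radial limits by `Φ⁺Φ⁻ = g`. `eq_of_common_radialLimits` makes them one constant: integrating the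
common limits against `(x - z)⁻¹ - (x - w)⁻¹`, with `z` above and `w` below, reproduces both
functions, so their values agree for all `z` and `w`. -/

theorem poissonKernel_eq (y t : ℝ) : y / (t ^ 2 + y ^ 2) = y⁻¹ * (1 + (t / y) ^ 2)⁻¹ := by
  rcases eq_or_ne y 0 with rfl | hy
  · simp
  · have h : t ^ 2 + y ^ 2 ≠ 0 := by positivity
    have h2 : 1 + (t / y) ^ 2 ≠ 0 := by positivity
    field_simp
    ring

theorem integrable_poissonKernel (y : ℝ) : Integrable fun t : ℝ => y / (t ^ 2 + y ^ 2) := by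
  simp_rw [poissonKernel_eq]
  rcases eq_or_ne y 0 with rfl | hy
  · simp
  · exact (integrable_inv_one_add_sq.comp_div hy).const_mul _

/-- At `y = 0` the kernel is identically `0`, as is `sign 0`. One formula thus covers both
half-planes and the principal value on the line itself. -/
theorem integral_poissonKernel (y : ℝ) :
    ∫ t : ℝ, y / (t ^ 2 + y ^ 2) = Real.pi * Real.sign y := by
  simp_rw [poissonKernel_eq, integral_const_mul]
  rw [Measure.integral_comp_div (fun t : ℝ => (1 + t ^ 2)⁻¹) y, integral_univ_inv_one_add_sq]
  rcases lt_trichotomy y 0 with hy | rfl | hy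
  · rw [abs_of_neg hy, Real.sign_of_neg hy, smul_eq_mul]
    have := hy.ne
    field_simp
  · simp
  · rw [abs_of_pos hy, Real.sign_of_pos hy, smul_eq_mul]
    field_simp

/-- The mass that the Poisson kernel of height `y` gives to the unit interval around its centre,
multiplied by `π`. -/
noncomputable def poissonMass (y : ℝ) : ℝ :=
  ∫ t in Metric.ball (0 : ℝ) 1, y / (t ^ 2 + y ^ 2)

theorem poissonMass_eq (y : ℝ) : poissonMass y = 2 * Real.arctan (1 / y) := by
  have h : Metric.ball (0 : ℝ) 1 = Set.Ioo (-1) 1 := by rw [Real.ball_eq_Ioo]; simp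
  rw [poissonMass, h, ← integral_Ioc_eq_integral_Ioo,
    ← intervalIntegral.integral_of_le (by norm_num)]
  have := integral_div_sq_add_sq (a := -1) (b := 1) (c := y)
  simp only [add_comm] at this ⊢
  rw [this, neg_div, Real.arctan_neg]
  ring

theorem poissonMass_zero : poissonMass 0 = 0 := by simp [poissonMass]

theorem abs_poissonMass_le (y : ℝ) : |poissonMass y| ≤ Real.pi := by
  rw [poissonMass_eq, abs_le]
  constructor <;>
    linarith [Real.arctan_lt_pi_div_two (1 / y), Real.neg_pi_div_two_lt_arctan (1 / y)]

theorem tendsto_poissonMass_right : Tendsto poissonMass (𝓝[>] 0) (𝓝 Real.pi) := by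
  have h : Tendsto (fun y : ℝ => 2 * Real.arctan (1 / y)) (𝓝[>] 0) (𝓝 (2 * (Real.pi / 2))) := by
    simp only [one_div]
    exact ((Real.tendsto_arctan_atTop.mono_right nhdsWithin_le_nhds).comp
      tendsto_inv_nhdsGT_zero).const_mul 2
  rw [mul_div_cancel₀ _ two_ne_zero] at h
  exact h.congr fun y => (poissonMass_eq y).symm

theorem poissonMass_neg (y : ℝ) : poissonMass (-y) = -poissonMass y := by
  simp [poissonMass, neg_div, integral_neg]

theorem tendsto_poissonMass_left : Tendsto poissonMass (𝓝[<] 0) (𝓝 (-Real.pi)) := by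
  have h : Tendsto (fun y : ℝ => -y) (𝓝[<] 0) (𝓝[>] 0) := by
    have := tendsto_neg_nhdsLT (a := (0 : ℝ))
    rwa [neg_zero] at this
  refine (tendsto_poissonMass_right.comp h).neg.congr fun y => ?_
  simp [poissonMass_neg]

/-! ### Principal values of the Cauchy kernel -/

theorem abs_sub_le_norm_sub (ω y x : ℝ) : |x - ω| ≤ ‖(x : ℂ) - (ω + y * I)‖ := by
  simpa using abs_re_le_norm ((x : ℂ) - (ω + y * I))

theorem abs_le_norm_sub (ω y x : ℝ) : |y| ≤ ‖(x : ℂ) - (ω + y * I)‖ := by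
  simpa using abs_im_le_norm ((x : ℂ) - (ω + y * I))

theorem measurableSet_truncation (c : ℂ) (p : ℝ × ℝ) :
    MeasurableSet {x : ℝ | p.1 < ‖(x : ℂ) - c‖ ∧ |x| < p.2} := by
  have h1 : IsOpen {x : ℝ | p.1 < ‖(x : ℂ) - c‖} := isOpen_lt continuous_const (by fun_prop)
  have h2 : IsOpen {x : ℝ | |x| < p.2} := isOpen_lt (by fun_prop) continuous_const
  exact (h1.inter h2).measurableSet

theorem volume_truncation_lt_top (c : ℂ) (p : ℝ × ℝ) :
    volume {x : ℝ | p.1 < ‖(x : ℂ) - c‖ ∧ |x| < p.2} < ⊤ := by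
  refine (measure_mono (t := Metric.ball (0 : ℝ) p.2) fun x hx => ?_).trans_lt measure_ball_lt_top
  simpa using hx.2

/-- An integrable function has its integral as principal value. -/
theorem hasPV_of_integrable {f : ℝ → ℂ} (hf : Integrable f) (c : ℂ) : HasPV f c (∫ x, f x) := by
  have hm := measurableSet_truncation c
  unfold HasPV truncatedIntegral
  simp_rw [← integral_indicator (hm _)]
  refine tendsto_integral_filter_of_dominated_convergence (fun x => ‖f x‖)
    (Eventually.of_forall fun p => (hf.indicator (hm p)).aestronglyMeasurable)
    (Eventually.of_forall fun p => Eventually.of_forall fun x => norm_indicator_le_norm_self _ _)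
    hf.norm ?_
  -- Away from this single point `x` has positive distance from `c`, so it eventually lies in the
  -- truncated domain.
  have hne : ∀ᵐ x : ℝ, x ≠ c.re := by simp [ae_iff]
  filter_upwards [hne] with x hx
  have hpos : 0 < ‖(x : ℂ) - c‖ := by
    rw [norm_pos_iff, sub_ne_zero]
    rintro rfl
    simp at hx
  refine tendsto_const_nhds.congr' ?_
  have h1 : ∀ᶠ ε in 𝓝[>] (0 : ℝ), ε < ‖(x : ℂ) - c‖ :=
    nhdsWithin_le_nhds (eventually_lt_nhds (b := ‖(x : ℂ) - c‖) hpos)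
  filter_upwards [h1.prod_mk (eventually_gt_atTop |x|)] with p hp
  rw [Set.indicator_of_mem]
  exact hp

theorem eventually_fst_pos : ∀ᶠ p in 𝓝[>] (0 : ℝ) ×ˢ (atTop : Filter ℝ), 0 < p.1 :=
  Eventually.prod_inl (self_mem_nhdsWithin : Set.Ioi (0 : ℝ) ∈ 𝓝[>] 0) _

/-- `f` is integrable over all the sets used to form principal values at `c`. -/
def TruncIntegrable (f : ℝ → ℂ) (c : ℂ) : Prop :=
  ∀ p : ℝ × ℝ, 0 < p.1 → IntegrableOn f {x : ℝ | p.1 < ‖(x : ℂ) - c‖ ∧ |x| < p.2}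

theorem HasPV.add {f h : ℝ → ℂ} {c J K : ℂ} (hf : HasPV f c J) (hh : HasPV h c K)
    (hfi : TruncIntegrable f c) (hhi : TruncIntegrable h c) :
    HasPV (fun x => f x + h x) c (J + K) := by
  refine (Tendsto.add hf hh).congr' ?_
  filter_upwards [eventually_fst_pos] with p hp
  exact (integral_add (hfi p hp) (hhi p hp)).symm

theorem HasPV.const_mul {f : ℝ → ℂ} {c J : ℂ} (hf : HasPV f c J) (a : ℂ) :
    HasPV (fun x => a * f x) c (a * J) :=
  (Tendsto.const_mul a hf).congr fun _ => (integral_const_mul _ _).symm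

theorem TruncIntegrable.add {f h : ℝ → ℂ} {c : ℂ} (hf : TruncIntegrable f c)
    (hh : TruncIntegrable h c) : TruncIntegrable (fun x => f x + h x) c :=
  fun p hp => (hf p hp).add (hh p hp)

theorem TruncIntegrable.const_mul {f : ℝ → ℂ} {c : ℂ} (hf : TruncIntegrable f c) (a : ℂ) :
    TruncIntegrable (fun x => a * f x) c :=
  fun p hp => Integrable.const_mul (hf p hp) a

theorem truncIntegrable_of_integrable {f : ℝ → ℂ} (hf : Integrable f) (c : ℂ) :
    TruncIntegrable f c := fun _ _ => hf.integrableOn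

theorem measurable_inv_sub (c : ℂ) : Measurable fun x : ℝ => ((x : ℂ) - c)⁻¹ :=
  ((by fun_prop : Continuous fun x : ℝ => (x : ℂ) - c).measurable).inv

theorem truncIntegrable_inv_sub (c : ℂ) : TruncIntegrable (fun x : ℝ => ((x : ℂ) - c)⁻¹) c := by
  intro p hp
  refine Measure.integrableOn_of_bounded (M := p.1⁻¹) (volume_truncation_lt_top c p).ne
    (measurable_inv_sub c).aestronglyMeasurable ?_
  refine (ae_restrict_mem (measurableSet_truncation c p)).mono fun x hx => ?_
  rw [norm_inv]
  exact inv_anti₀ hp hx.1.le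

/-- Over a symmetric set only the Poisson part of the Cauchy kernel contributes. -/
theorem setIntegral_inv_sub_of_symmetric {B : Set ℝ} (hB : MeasurableSet B)
    (hsymm : ∀ t, -t ∈ B ↔ t ∈ B) (y : ℝ)
    (hint : IntegrableOn (fun t : ℝ => ((t : ℂ) - y * I)⁻¹) B) :
    ∫ t in B, ((t : ℂ) - y * I)⁻¹ = I * ((∫ t in B, y / (t ^ 2 + y ^ 2) : ℝ) : ℂ) := by
  set f : ℝ → ℂ := B.indicator fun t : ℝ => ((t : ℂ) - y * I)⁻¹ with hf
  have hfi : Integrable f := hint.integrable_indicator hB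
  have hfi' : Integrable fun t => f (-t) := hfi.comp_neg
  -- The real part of the kernel is odd and cancels under reflection; the imaginary part is the even
  -- Poisson kernel.
  have key : ∀ t, f t + f (-t) =
      2 * I * ((B.indicator (fun t : ℝ => y / (t ^ 2 + y ^ 2)) t : ℝ) : ℂ) := by
    intro t
    by_cases ht : t ∈ B
    · rw [hf, Set.indicator_of_mem ht, Set.indicator_of_mem ((hsymm t).2 ht),
        Set.indicator_of_mem ht]
      push_cast
      have hfac : (t : ℂ) ^ 2 + (y : ℂ) ^ 2 = ((t : ℂ) - y * I) * (t + y * I) := by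
        ring_nf
        simp
      -- At the singular point both sides are `0` by the convention for division by zero.
      by_cases h0 : t = 0 ∧ y = 0
      · simp [h0.1, h0.2]
      · have hr : t ^ 2 + y ^ 2 ≠ 0 := by
          intro h
          exact h0 ⟨by nlinarith [sq_nonneg t, sq_nonneg y], by nlinarith [sq_nonneg t, sq_nonneg y]⟩
        have hc : ((t : ℂ) - y * I) * (t + y * I) ≠ 0 := by
          rw [← hfac]; exact_mod_cast hr
        have h1 := left_ne_zero_of_mul hc
        have h2 := right_ne_zero_of_mul hc
        have h3 : -(t : ℂ) - y * I ≠ 0 := by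
          intro h; apply h2; linear_combination -h
        rw [hfac]
        field_simp
        ring
    · rw [hf, Set.indicator_of_notMem ht, Set.indicator_of_notMem (fun h => ht ((hsymm t).1 h)),
        Set.indicator_of_notMem ht]
      simp
  have h2 : 2 * ∫ t, f t = 2 * (I * ((∫ t in B, y / (t ^ 2 + y ^ 2) : ℝ) : ℂ)) := by
    calc 2 * ∫ t, f t = (∫ t, f t) + ∫ t, f (-t) := by rw [integral_neg_eq_self f]; ring
      _ = ∫ t, (f t + f (-t)) := (integral_add hfi hfi').symm
      _ = ∫ t, 2 * I * ((B.indicator (fun t : ℝ => y / (t ^ 2 + y ^ 2)) t : ℝ) : ℂ) := by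
        simp_rw [key]
      _ = _ := by
        rw [integral_const_mul, integral_complex_ofReal, integral_indicator hB]
        ring
  rw [← integral_indicator hB]
  exact mul_left_cancel₀ two_ne_zero h2

theorem norm_neg_sub_mul_I (y t : ℝ) : ‖((-t : ℝ) : ℂ) - y * I‖ = ‖(t : ℂ) - y * I‖ := by
  rw [← norm_conj ((t : ℂ) - y * I), ← norm_neg]
  congr 1
  simp [add_comm]

theorem measurableSet_centered (ω y ε R : ℝ) :
    MeasurableSet {x : ℝ | ε < ‖(x : ℂ) - (ω + y * I)‖ ∧ |x - ω| < R} := by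
  have h1 : IsOpen {x : ℝ | ε < ‖(x : ℂ) - (ω + y * I)‖} := isOpen_lt continuous_const (by fun_prop)
  have h2 : IsOpen {x : ℝ | |x - ω| < R} := isOpen_lt (by fun_prop) continuous_const
  exact (h1.inter h2).measurableSet

/-- The outer cut-off is centred at `ω` rather than at `0`, so that translation by `ω` produces a
set symmetric about the origin. -/
theorem setIntegral_inv_sub_centered (ω y : ℝ) {ε : ℝ} (hε : 0 < ε) (R : ℝ) :
    ∫ x in {x : ℝ | ε < ‖(x : ℂ) - (ω + y * I)‖ ∧ |x - ω| < R}, ((x : ℂ) - (ω + y * I))⁻¹ =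
      I * truncatedIntegral (fun t => ((y / (t ^ 2 + y ^ 2) : ℝ) : ℂ)) (y * I) (ε, R) := by
  have hm := measurableSet_truncation (y * I) (ε, R)
  rw [truncatedIntegral, integral_complex_ofReal, ← setIntegral_inv_sub_of_symmetric hm (fun t => ?_) y
    (truncIntegrable_inv_sub (y * I) (ε, R) hε), ← integral_indicator hm,
    ← integral_indicator, ← integral_add_right_eq_self _ ω]
  · refine integral_congr_ae (Eventually.of_forall fun t => ?_)
    have h : ((t + ω : ℝ) : ℂ) - (ω + y * I) = t - y * I := by push_cast; ring
    simp only [Set.indicator_apply, Set.mem_ofPred_eq, h, add_sub_cancel_right]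
  · exact measurableSet_centered ω y ε R
  · simp only [Set.mem_ofPred_eq, norm_neg_sub_mul_I, abs_neg]

theorem hasPV_poissonKernel (y : ℝ) :
    HasPV (fun t => ((y / (t ^ 2 + y ^ 2) : ℝ) : ℂ)) (y * I)
      ((Real.pi * Real.sign y : ℝ) : ℂ) := by
  rw [← integral_poissonKernel, ← integral_complex_ofReal]
  exact hasPV_of_integrable (integrable_poissonKernel y).ofReal _

/-- The centred window misses at most two end intervals of length `2|ω|` each, where the kernel is
at most `(R - |ω|)⁻¹`. So recentring the truncation costs nothing in the limit `R → ∞`. -/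
theorem norm_setIntegral_inv_sub_diff_le (ω y ε : ℝ) {R : ℝ} (hR : |ω| < R) :
    ‖∫ x in {x : ℝ | ε < ‖(x : ℂ) - (ω + y * I)‖ ∧ |x| < R} \
        {x : ℝ | ε < ‖(x : ℂ) - (ω + y * I)‖ ∧ |x - ω| < R - |ω|}, ((x : ℂ) - (ω + y * I))⁻¹‖ ≤
      (R - |ω|)⁻¹ * (4 * |ω|) := by
  have hpos : 0 < R - |ω| := sub_pos.2 hR
  set D := {x : ℝ | ε < ‖(x : ℂ) - (ω + y * I)‖ ∧ |x| < R} \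
        {x : ℝ | ε < ‖(x : ℂ) - (ω + y * I)‖ ∧ |x - ω| < R - |ω|} with hD
  have hsub : D ⊆ Set.Icc (-R) (-R + 2 * |ω|) ∪ Set.Icc (R - 2 * |ω|) R := by
    rintro x ⟨⟨h1, h2⟩, h3⟩
    have h4 : R - |ω| ≤ |x - ω| := not_lt.1 fun h => h3 ⟨h1, h⟩
    obtain ⟨h5, h6⟩ := abs_lt.1 h2
    rcases le_abs.1 h4 with h | h
    · right; constructor <;> linarith [neg_abs_le ω]
    · left; constructor <;> linarith [le_abs_self ω]
  have hvol : volume (Set.Icc (-R) (-R + 2 * |ω|) ∪ Set.Icc (R - 2 * |ω|) R) ≤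
      ENNReal.ofReal (4 * |ω|) := by
    refine (measure_union_le _ _).trans ?_
    rw [Real.volume_Icc, Real.volume_Icc, ← ENNReal.ofReal_add (by simp) (by simp)]
    exact ENNReal.ofReal_le_ofReal (by linarith)
  have hvolD : volume D ≤ ENNReal.ofReal (4 * |ω|) := (measure_mono hsub).trans hvol
  refine (norm_setIntegral_le_of_norm_le_const (C := (R - |ω|)⁻¹)
    (hvolD.trans_lt ENNReal.ofReal_lt_top) ?_).trans ?_
  · rintro x ⟨⟨h1, h2⟩, h3⟩
    have h4 : R - |ω| ≤ |x - ω| := not_lt.1 fun h => h3 ⟨h1, h⟩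
    rw [norm_inv]
    exact inv_anti₀ hpos (h4.trans (abs_sub_le_norm_sub ω y x))
  · gcongr
    exact ENNReal.toReal_le_of_le_ofReal (by positivity) hvolD

theorem hasPV_inv_sub (ω y : ℝ) :
    HasPV (fun x : ℝ => ((x : ℂ) - (ω + y * I))⁻¹) (ω + y * I)
      (I * ((Real.pi * Real.sign y : ℝ) : ℂ)) := by
  have hshift : Tendsto (fun p : ℝ × ℝ => (p.1, p.2 - |ω|)) (𝓝[>] (0 : ℝ) ×ˢ atTop)
      (𝓝[>] (0 : ℝ) ×ˢ atTop) :=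
    tendsto_id.prodMap (tendsto_atTop_add_const_right _ _ tendsto_id)
  have hmain := ((hasPV_poissonKernel y).comp hshift).const_mul I
  have herr : Tendsto (fun p : ℝ × ℝ =>
      ∫ x in {x : ℝ | p.1 < ‖(x : ℂ) - (ω + y * I)‖ ∧ |x| < p.2} \
        {x : ℝ | p.1 < ‖(x : ℂ) - (ω + y * I)‖ ∧ |x - ω| < p.2 - |ω|}, ((x : ℂ) - (ω + y * I))⁻¹)
      (𝓝[>] (0 : ℝ) ×ˢ atTop) (𝓝 0) := by
    have hb : Tendsto (fun p : ℝ × ℝ => (p.2 - |ω|)⁻¹ * (4 * |ω|)) (𝓝[>] (0 : ℝ) ×ˢ atTop)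
        (𝓝 (0 * (4 * |ω|))) :=
      ((tendsto_inv_atTop_zero.comp (tendsto_atTop_add_const_right _ (-|ω|) tendsto_id)).comp
        tendsto_snd).mul_const _
    rw [zero_mul] at hb
    refine squeeze_zero_norm' ?_ hb
    filter_upwards [(eventually_gt_atTop |ω|).prod_inr (𝓝[>] (0 : ℝ))] with p hp
    exact norm_setIntegral_inv_sub_diff_le ω y p.1 hp
  have hsum := hmain.add herr
  rw [add_zero] at hsum
  refine hsum.congr' ?_
  filter_upwards [eventually_fst_pos] with p hp
  have hsub : {x : ℝ | p.1 < ‖(x : ℂ) - (ω + y * I)‖ ∧ |x - ω| < p.2 - |ω|} ⊆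
      {x : ℝ | p.1 < ‖(x : ℂ) - (ω + y * I)‖ ∧ |x| < p.2} := by
    rintro x ⟨h1, h2⟩
    refine ⟨h1, ?_⟩
    have := abs_add_le (x - ω) ω
    rw [sub_add_cancel] at this
    linarith
  have hint := truncIntegrable_inv_sub (ω + y * I) p hp
  have hm : MeasurableSet {x : ℝ | p.1 < ‖(x : ℂ) - (ω + y * I)‖ ∧ |x - ω| < p.2 - |ω|} :=
    measurableSet_centered ω y p.1 (p.2 - |ω|)
  have h1 := setIntegral_inv_sub_centered ω y hp (p.2 - |ω|)
  have h2 := setIntegral_sdiff hm hint hsub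
  simp only [Function.comp_apply]
  rw [← h1, h2, truncatedIntegral]
  ring

theorem hasPV_inv_sub_local (ω y : ℝ) :
    HasPV ((Metric.ball ω 1).indicator fun x : ℝ => ((x : ℂ) - (ω + y * I))⁻¹) (ω + y * I)
      (I * (poissonMass y : ℂ)) := by
  have hP : HasPV ((Metric.ball (0 : ℝ) 1).indicator fun t => ((y / (t ^ 2 + y ^ 2) : ℝ) : ℂ))
      (y * I) (poissonMass y : ℂ) := by
    have hi : Integrable fun t : ℝ => ((y / (t ^ 2 + y ^ 2) : ℝ) : ℂ) :=
      (integrable_poissonKernel y).ofReal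
    have := hasPV_of_integrable
      (hi.indicator (Metric.isOpen_ball (x := (0 : ℝ)) (ε := 1)).measurableSet) (y * I)
    rw [integral_indicator Metric.isOpen_ball.measurableSet] at this
    convert this using 1
    exact (integral_ofReal (𝕜 := ℂ)).symm
  refine (Tendsto.const_mul I hP).congr' ?_
  filter_upwards [eventually_fst_pos, (eventually_gt_atTop (|ω| + 1)).prod_inr (𝓝[>] (0 : ℝ))]
    with p hp hR
  -- Once `R > |ω| + 1` the outer truncation contains the unit ball about `ω`, and the ball itself
  -- acts as a centred window of radius `1`.
  have h1 := setIntegral_inv_sub_centered ω y hp 1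
  have e1 : truncatedIntegral ((Metric.ball (0 : ℝ) 1).indicator
      fun t => ((y / (t ^ 2 + y ^ 2) : ℝ) : ℂ)) (y * I) p =
      truncatedIntegral (fun t => ((y / (t ^ 2 + y ^ 2) : ℝ) : ℂ)) (y * I) (p.1, 1) := by
    rw [truncatedIntegral, truncatedIntegral, setIntegral_indicator Metric.isOpen_ball.measurableSet]
    congr 2
    ext t
    simp only [Set.mem_inter_iff, Set.mem_ofPred_eq, Metric.mem_ball, dist_zero_right,
      Real.norm_eq_abs]
    constructor
    · exact fun h => ⟨h.1.1, h.2⟩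
    · exact fun h => ⟨⟨h.1, by linarith [h.2, abs_nonneg ω]⟩, h.2⟩
  rw [e1, ← h1, truncatedIntegral, setIntegral_indicator Metric.isOpen_ball.measurableSet]
  congr 2
  ext x
  simp only [Set.mem_inter_iff, Set.mem_ofPred_eq, Metric.mem_ball, Real.dist_eq]
  have h3 := abs_add_le (x - ω) ω
  rw [sub_add_cancel] at h3
  constructor
  · exact fun h => ⟨⟨h.1, by linarith [h.2]⟩, h.2⟩
  · exact fun h => ⟨h.1.1, h.2⟩

/-! ### Cauchy integrals of Hölder continuous functions that decay at infinity -/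

/-- `s` is locally uniformly Hölder continuous and decays like a power at infinity. -/
structure HolderDecay (s : ℝ → ℂ) (C α β : ℝ) : Prop where
  continuous : Continuous s
  const_nonneg : 0 ≤ C
  exponent_pos : 0 < α
  rate_pos : 0 < β
  norm_sub_le : ∀ x y : ℝ, |x - y| ≤ 1 → ‖s x - s y‖ ≤ C * |x - y| ^ α
  norm_le : ∀ x : ℝ, ‖s x‖ ≤ C * (1 + |x|) ^ (-β)

/-- `s` minus its value at `ω` near `ω`. -/
noncomputable def regularPart (s : ℝ → ℂ) (ω x : ℝ) : ℂ :=
  s x - (Metric.ball ω 1).indicator (fun _ => s ω) x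

/-- An integrable bound for `regularPart s ω x / (x - z)` over all `z` above and below `ω`. -/
noncomputable def cauchyMajorant (C α β ω x : ℝ) : ℝ :=
  C * (Metric.ball 0 1).indicator (fun t : ℝ => |t| ^ (α - 1)) (x - ω) +
    2 * C * ((1 + |x|) ^ (-(1 + β)) + (1 + |x - ω|) ^ (-(1 + β)))

theorem integrable_indicator_abs_rpow {α : ℝ} (hα : 0 < α) :
    Integrable ((Metric.ball 0 1).indicator fun t : ℝ => |t| ^ (α - 1)) := by
  have h : ((Metric.ball 0 1).indicator fun t : ℝ => |t| ^ (α - 1)) =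
      fun t : ℝ => (Set.Iio (1 : ℝ)).indicator (fun r => r ^ (α - 1)) ‖t‖ := by
    ext t
    by_cases ht : |t| < 1
    · rw [Set.indicator_of_mem (by simpa using ht), Set.indicator_of_mem (by simpa using ht),
        Real.norm_eq_abs]
    · rw [Set.indicator_of_notMem (by simpa using ht), Set.indicator_of_notMem (by simpa using ht)]
  rw [h, integrable_fun_norm_addHaar volume]
  simp only [Module.finrank_self, Nat.sub_self, pow_zero, one_smul]
  rw [integrableOn_indicator_iff measurableSet_Iio]
  rw [Set.Iio_inter_Ioi, ← integrableOn_Ioc_iff_integrableOn_Ioo,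
    ← intervalIntegrable_iff_integrableOn_Ioc_of_le zero_le_one]
  exact intervalIntegral.intervalIntegrable_rpow' (by linarith)

theorem integrable_one_add_abs_rpow {β : ℝ} (hβ : 0 < β) :
    Integrable fun t : ℝ => (1 + |t|) ^ (-(1 + β)) :=
  integrable_one_add_norm (μ := volume) (E := ℝ) (by simpa using hβ)

theorem integrable_cauchyMajorant (C : ℝ) {α β : ℝ} (hα : 0 < α) (hβ : 0 < β) (ω : ℝ) :
    Integrable (cauchyMajorant C α β ω) :=
  (((integrable_indicator_abs_rpow hα).comp_sub_right ω).const_mul C).add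
    (((integrable_one_add_abs_rpow hβ).add
      ((integrable_one_add_abs_rpow hβ).comp_sub_right ω)).const_mul _)

/-- Translation invariance. It makes the bound on the Cauchy integral uniform in `ω`, hence `φ`
bounded on the whole plane. -/
theorem integral_cauchyMajorant (C : ℝ) {α β : ℝ} (hα : 0 < α) (hβ : 0 < β) (ω : ℝ) :
    ∫ x, cauchyMajorant C α β ω x = ∫ x, cauchyMajorant C α β 0 x := by
  have h1 := integrable_indicator_abs_rpow hα
  have h2 := integrable_one_add_abs_rpow hβ
  have key : ∀ ω : ℝ, ∫ x, cauchyMajorant C α β ω x =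
      C * (∫ t, (Metric.ball 0 1).indicator (fun t : ℝ => |t| ^ (α - 1)) t) +
        2 * C * ((∫ t : ℝ, (1 + |t|) ^ (-(1 + β))) + ∫ t : ℝ, (1 + |t|) ^ (-(1 + β))) := by
    intro ω
    unfold cauchyMajorant
    have h3 : Integrable fun x : ℝ =>
        2 * C * ((1 + |x|) ^ (-(1 + β)) + (1 + |x - ω|) ^ (-(1 + β))) :=
      (h2.add (h2.comp_sub_right ω)).const_mul _
    rw [integral_add ((h1.comp_sub_right ω).const_mul C) h3, integral_const_mul, integral_const_mul,
      integral_add h2 (h2.comp_sub_right ω),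
      integral_sub_right_eq_self (fun t => (Metric.ball 0 1).indicator (fun t : ℝ => |t| ^ (α - 1)) t),
      integral_sub_right_eq_self (fun t : ℝ => (1 + |t|) ^ (-(1 + β)))]
  rw [key, key]

/-- Replacing the larger base by the smaller leaves a single power. With `a = 1 + |x|` and `b = 1 +
|x - ω|` this separates the decay of the function from that of the kernel, with a constant
independent of `ω`. -/
theorem rpow_neg_mul_inv_le {a b β : ℝ} (ha : 0 < a) (hb : 0 < b) (hβ : 0 < β) :
    a ^ (-β) * b⁻¹ ≤ a ^ (-(1 + β)) + b ^ (-(1 + β)) := by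
  have e : ∀ c : ℝ, 0 < c → c ^ (-(1 + β)) = c ^ (-β) * c⁻¹ := fun c hc => by
    rw [← Real.rpow_neg_one c, ← Real.rpow_add hc]
    congr 1
    ring
  have pa := Real.rpow_pos_of_pos ha (-(1 + β))
  have pb := Real.rpow_pos_of_pos hb (-(1 + β))
  rcases le_total a b with h | h
  · have : a ^ (-β) * b⁻¹ ≤ a ^ (-(1 + β)) := by
      rw [e a ha]
      gcongr
    linarith
  · have : a ^ (-β) * b⁻¹ ≤ b ^ (-(1 + β)) := by
      rw [e b hb]
      gcongr ?_ * _
      exact Real.rpow_le_rpow_of_nonpos hb h (by linarith)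
    linarith

variable {s : ℝ → ℂ} {C α β : ℝ}

/-- Since `|x - z| ≥ |x - ω|`, the height `y` drops out. Near `ω` the Hölder bound leaves the
integrable singularity `|x - ω| ^ (α - 1)`; farther away the decay of `s` takes over. -/
theorem HolderDecay.norm_regularPart_mul_le (hs : HolderDecay s C α β) (ω y x : ℝ) :
    ‖regularPart s ω x * ((x : ℂ) - (ω + y * I))⁻¹‖ ≤ cauchyMajorant C α β ω x := by
  have hC := hs.const_nonneg
  have hfar : 0 ≤ 2 * C * ((1 + |x|) ^ (-(1 + β)) + (1 + |x - ω|) ^ (-(1 + β))) := by positivity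
  have hz := abs_sub_le_norm_sub ω y x
  rw [norm_mul, norm_inv, cauchyMajorant, regularPart]
  by_cases hx : |x - ω| < 1
  · have hx1 : x ∈ Metric.ball ω 1 := by simpa [Real.dist_eq] using hx
    have hx2 : x - ω ∈ Metric.ball (0 : ℝ) 1 := by simpa using hx
    rw [Set.indicator_of_mem hx1, Set.indicator_of_mem hx2]
    refine le_trans ?_ (le_add_of_nonneg_right hfar)
    rcases eq_or_ne x ω with rfl | hne
    · simp only [sub_self, norm_zero, zero_mul]
      positivity
    · have hpos : 0 < |x - ω| := abs_pos.2 (sub_ne_zero.2 hne)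
      rw [Real.rpow_sub_one hpos.ne', ← mul_div_assoc, div_eq_mul_inv]
      gcongr
      exact hs.norm_sub_le x ω hx.le
  · have hx1 : x ∉ Metric.ball ω 1 := by simpa [Real.dist_eq] using hx
    have hx2 : x - ω ∉ Metric.ball (0 : ℝ) 1 := by simpa using hx
    rw [Set.indicator_of_notMem hx1, Set.indicator_of_notMem hx2, sub_zero, mul_zero, zero_add]
    push Not at hx
    -- The factor `2` comes from `1 + |x - ω| ≤ 2|x - ω|` outside the unit ball.
    have h1 : ‖(x : ℂ) - (ω + y * I)‖⁻¹ ≤ 2 * (1 + |x - ω|)⁻¹ := by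
      rw [← div_eq_mul_inv, ← inv_div]
      exact inv_anti₀ (by positivity) (by linarith)
    calc ‖s x‖ * ‖(x : ℂ) - (ω + y * I)‖⁻¹ ≤ C * (1 + |x|) ^ (-β) * (2 * (1 + |x - ω|)⁻¹) := by
          gcongr
          exact hs.norm_le x
      _ = 2 * C * ((1 + |x|) ^ (-β) * (1 + |x - ω|)⁻¹) := by ring
      _ ≤ _ := by
        gcongr
        exact rpow_neg_mul_inv_le (by positivity) (by positivity) hs.rate_pos

theorem HolderDecay.measurable_regularPart (hs : HolderDecay s C α β) (ω : ℝ) :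
    Measurable (regularPart s ω) :=
  hs.continuous.measurable.sub (measurable_const.indicator Metric.isOpen_ball.measurableSet)

theorem HolderDecay.integrable_regularPart_mul (hs : HolderDecay s C α β) (ω y : ℝ) :
    Integrable fun x : ℝ => regularPart s ω x * ((x : ℂ) - (ω + y * I))⁻¹ :=
  (integrable_cauchyMajorant C hs.exponent_pos hs.rate_pos ω).mono'
    ((hs.measurable_regularPart ω).mul (measurable_inv_sub _)).aestronglyMeasurable
    (Eventually.of_forall (hs.norm_regularPart_mul_le ω y))

/-- The absolutely convergent part of the Cauchy integral of `s` at `ω + i y`. -/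
noncomputable def regularIntegral (s : ℝ → ℂ) (ω y : ℝ) : ℂ :=
  ∫ x : ℝ, regularPart s ω x * ((x : ℂ) - (ω + y * I))⁻¹

/-- The principal value of `∫ (L + s(x)) / (x - z) dx` at `z = ω + i y`. -/
noncomputable def cauchyPV (L : ℂ) (s : ℝ → ℂ) (ω y : ℝ) : ℂ :=
  L * (I * ((Real.pi * Real.sign y : ℝ) : ℂ)) +
    (regularIntegral s ω y + s ω * (I * (poissonMass y : ℂ)))

theorem truncIntegrable_indicator_inv_sub (ω : ℝ) (c : ℂ) :
    TruncIntegrable ((Metric.ball ω 1).indicator fun x : ℝ => ((x : ℂ) - c)⁻¹) c :=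
  fun p hp => (truncIntegrable_inv_sub c p hp).indicator Metric.isOpen_ball.measurableSet

theorem HolderDecay.hasPV (hs : HolderDecay s C α β) (L : ℂ) (ω y : ℝ) :
    HasPV (fun x => (L + s x) / ((x : ℂ) - (ω + y * I))) (ω + y * I) (cauchyPV L s ω y) := by
  have hi := hs.integrable_regularPart_mul ω y
  have ti1 := truncIntegrable_of_integrable hi (ω + y * I)
  have ti2 := (truncIntegrable_indicator_inv_sub ω (ω + y * I)).const_mul (s ω)
  have key := ((hasPV_inv_sub ω y).const_mul L).add
    ((hasPV_of_integrable hi (ω + y * I)).add ((hasPV_inv_sub_local ω y).const_mul (s ω)) ti1 ti2)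
    ((truncIntegrable_inv_sub _).const_mul L) (ti1.add ti2)
  refine Eq.subst (motive := fun f => HasPV f _ _) ?_ key
  ext x
  by_cases hx : x ∈ Metric.ball ω 1
  · simp only [regularPart, Set.indicator_of_mem hx]
    ring
  · simp only [regularPart, Set.indicator_of_notMem hx]
    ring

theorem HolderDecay.norm_cauchyPV_le (hs : HolderDecay s C α β) (L : ℂ) :
    ∃ M : ℝ, ∀ ω y : ℝ, ‖cauchyPV L s ω y‖ ≤ M := by
  refine ⟨‖L‖ * Real.pi + ((∫ x, cauchyMajorant C α β 0 x) + C * Real.pi), fun ω y => ?_⟩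
  have h1 : ‖L * (I * ((Real.pi * Real.sign y : ℝ) : ℂ))‖ ≤ ‖L‖ * Real.pi := by
    rw [norm_mul, norm_mul, norm_I, one_mul, norm_real, Real.norm_eq_abs, abs_mul,
      abs_of_pos Real.pi_pos]
    gcongr
    refine mul_le_of_le_one_right Real.pi_pos.le ?_
    rcases Real.sign_apply_eq y with h | h | h <;> simp [h]
  have h2 : ‖regularIntegral s ω y‖ ≤ ∫ x, cauchyMajorant C α β 0 x := by
    rw [← integral_cauchyMajorant C hs.exponent_pos hs.rate_pos ω]
    exact norm_integral_le_of_norm_le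
      (integrable_cauchyMajorant C hs.exponent_pos hs.rate_pos ω)
      (Eventually.of_forall (hs.norm_regularPart_mul_le ω y))
  have h3 : ‖s ω * (I * (poissonMass y : ℂ))‖ ≤ C * Real.pi := by
    rw [norm_mul, norm_mul, norm_I, one_mul, norm_real, Real.norm_eq_abs]
    refine mul_le_mul ((hs.norm_le ω).trans ?_) (abs_poissonMass_le y) (abs_nonneg _) hs.const_nonneg
    refine mul_le_of_le_one_right hs.const_nonneg ?_
    exact Real.rpow_le_one_of_one_le_of_nonpos (by linarith [abs_nonneg ω])
      (by linarith [hs.rate_pos])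
  exact (norm_add_le _ _).trans (add_le_add h1 ((norm_add_le _ _).trans (add_le_add h2 h3)))

/-- The majorant does not involve `y`, so dominated convergence applies. The regular part therefore
has no jump; all of the jump comes from `sign y` and `poissonMass y`. -/
theorem HolderDecay.tendsto_regularIntegral (hs : HolderDecay s C α β) (ω : ℝ) :
    Tendsto (regularIntegral s ω) (𝓝 0) (𝓝 (regularIntegral s ω 0)) := by
  refine tendsto_integral_filter_of_dominated_convergence (cauchyMajorant C α β ω)
    (Eventually.of_forall fun y => (hs.integrable_regularPart_mul ω y).aestronglyMeasurable)
    (Eventually.of_forall fun y => Eventually.of_forall (hs.norm_regularPart_mul_le ω y))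
    (integrable_cauchyMajorant C hs.exponent_pos hs.rate_pos ω) ?_
  have hne : ∀ᵐ x : ℝ, x ≠ ω := by simp [ae_iff]
  filter_upwards [hne] with x hx
  have h0 : (x : ℂ) - (ω + (0 : ℝ) * I) ≠ 0 := by
    simpa [sub_eq_zero] using hx
  refine Tendsto.const_mul _ (Tendsto.inv₀ ?_ h0)
  exact Continuous.tendsto (f := fun y : ℝ => (x : ℂ) - (ω + y * I)) (by fun_prop) 0

theorem HolderDecay.tendsto_cauchyPV_right (hs : HolderDecay s C α β) (L : ℂ) (ω : ℝ) :
    Tendsto (cauchyPV L s ω) (𝓝[>] 0)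
      (𝓝 (cauchyPV L s ω 0 + Real.pi * I * (L + s ω))) := by
  have h1 := (hs.tendsto_regularIntegral ω).mono_left (nhdsWithin_le_nhds (s := Set.Ioi 0))
  have h2 := (continuous_ofReal.tendsto _).comp tendsto_poissonMass_right
  have h3 : Tendsto (fun y => L * (I * ((Real.pi * Real.sign y : ℝ) : ℂ))) (𝓝[>] 0)
      (𝓝 (L * (I * Real.pi))) := by
    refine tendsto_const_nhds.congr' ?_
    filter_upwards [self_mem_nhdsWithin] with y hy
    rw [Real.sign_of_pos hy, mul_one]
  refine Eq.subst (motive := fun a => Tendsto _ _ (𝓝 a)) ?_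
    (h3.add (h1.add ((h2.const_mul I).const_mul (s ω))))
  simp only [cauchyPV, Real.sign_zero, poissonMass_zero]
  push_cast
  ring

theorem HolderDecay.tendsto_cauchyPV_left (hs : HolderDecay s C α β) (L : ℂ) (ω : ℝ) :
    Tendsto (cauchyPV L s ω) (𝓝[<] 0)
      (𝓝 (cauchyPV L s ω 0 - Real.pi * I * (L + s ω))) := by
  have h1 := (hs.tendsto_regularIntegral ω).mono_left (nhdsWithin_le_nhds (s := Set.Iio 0))
  have h2 := (continuous_ofReal.tendsto _).comp tendsto_poissonMass_left
  have h3 : Tendsto (fun y => L * (I * ((Real.pi * Real.sign y : ℝ) : ℂ))) (𝓝[<] 0)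
      (𝓝 (L * (I * (-Real.pi)))) := by
    refine tendsto_const_nhds.congr' ?_
    filter_upwards [self_mem_nhdsWithin] with y hy
    rw [Real.sign_of_neg hy, mul_neg_one, ofReal_neg]
  refine Eq.subst (motive := fun a => Tendsto _ _ (𝓝 a)) ?_
    (h3.add (h1.add ((h2.const_mul I).const_mul (s ω))))
  simp only [cauchyPV, Real.sign_zero, poissonMass_zero]
  push_cast
  ring

/-! ### Analyticity of the Cauchy integral off the real line. -/

theorem HolderDecay.integrable_mul_inv_sub (hs : HolderDecay s C α β) {z : ℂ} (hz : z.im ≠ 0) :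
    Integrable fun x : ℝ => s x * ((x : ℂ) - z)⁻¹ := by
  have h1 := hs.integrable_regularPart_mul z.re z.im
  rw [re_add_im] at h1
  have h2 : Integrable ((Metric.ball z.re 1).indicator fun x : ℝ => ((x : ℂ) - z)⁻¹) := by
    rw [integrable_indicator_iff Metric.isOpen_ball.measurableSet]
    refine Measure.integrableOn_of_bounded (M := |z.im|⁻¹) measure_ball_lt_top.ne
      (measurable_inv_sub z).aestronglyMeasurable (Eventually.of_forall fun x => ?_)
    rw [norm_inv]
    have := abs_le_norm_sub z.re z.im x
    rw [re_add_im] at this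
    exact inv_anti₀ (abs_pos.2 hz) this
  refine (h1.add (h2.const_mul (s z.re))).congr (Eventually.of_forall fun x => ?_)
  by_cases hx : x ∈ Metric.ball z.re 1
  · simp only [regularPart, Pi.add_apply, Set.indicator_of_mem hx]
    ring
  · simp only [regularPart, Pi.add_apply, Set.indicator_of_notMem hx]
    ring

/-- `cauchyPV` is built around `Re z` and is not visibly analytic in `z`. Uniqueness of principal
values replaces it by an ordinary integral plus a constant in each half-plane. -/
theorem HolderDecay.cauchyPV_eq (hs : HolderDecay s C α β) (L : ℂ) {z : ℂ} (hz : z.im ≠ 0) :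
    cauchyPV L s z.re z.im =
      L * (I * ((Real.pi * Real.sign z.im : ℝ) : ℂ)) + ∫ x : ℝ, s x * ((x : ℂ) - z)⁻¹ := by
  have h1 := hs.hasPV L z.re z.im
  have h0 := hasPV_inv_sub z.re z.im
  rw [re_add_im] at h0 h1
  have hi := hs.integrable_mul_inv_sub hz
  have h2 := (h0.const_mul L).add (hasPV_of_integrable hi z)
    ((truncIntegrable_inv_sub _).const_mul L) (truncIntegrable_of_integrable hi _)
  refine tendsto_nhds_unique h1 (Eq.subst (motive := fun f => HasPV f _ _) ?_ h2)
  ext x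
  ring

theorem HolderDecay.differentiableAt_integral (hs : HolderDecay s C α β) {z : ℂ} (hz : z.im ≠ 0) :
    DifferentiableAt ℂ (fun w => ∫ x : ℝ, s x * ((x : ℂ) - w)⁻¹) z := by
  have hpos : 0 < |z.im| := abs_pos.2 hz
  have him : ∀ᶠ w in 𝓝 z, w.im ≠ 0 := continuous_im.continuousAt.eventually_ne hz
  have hne : ∀ (w : ℂ) (x : ℝ), w.im ≠ 0 → (x : ℂ) - w ≠ 0 := fun w x hw h => hw (by
    have := congrArg im h
    simpa using this)
  -- Moving `z` by less than half its distance from the line costs at most a factor `2` in the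
  -- distance to `x`, hence the `4` in the bound on the squared kernel below.
  have hclose : ∀ w ∈ Metric.ball z (|z.im| / 2), ∀ x : ℝ, ‖(x : ℂ) - z‖ ≤ 2 * ‖(x : ℂ) - w‖ := by
    intro w hw x
    rw [Metric.mem_ball, dist_eq_norm] at hw
    have h1 := norm_add_le ((x : ℂ) - w) (w - z)
    have h2 := abs_le_norm_sub z.re z.im x
    rw [re_add_im] at h2
    rw [sub_add_sub_cancel] at h1
    linarith
  have hball : ∀ w ∈ Metric.ball z (|z.im| / 2), w.im ≠ 0 := by
    intro w hw h
    have h1 := (abs_im_le_norm (w - z)).trans_lt (by simpa [dist_eq_norm] using hw)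
    rw [sub_im, h, zero_sub, abs_neg] at h1
    linarith
  -- This is `4C / |x - z|²`, written through the Poisson kernel to reuse its integrability.
  have hbound : Integrable fun x : ℝ =>
      4 * C * (|z.im|⁻¹ * (|z.im| / ((x - z.re) ^ 2 + |z.im| ^ 2))) :=
    (((integrable_poissonKernel |z.im|).comp_sub_right z.re).const_mul _).const_mul _
  refine (hasDerivAt_integral_of_dominated_loc_of_deriv_le (μ := volume)
    (F' := fun w x => s x * (((x : ℂ) - w) ^ 2)⁻¹)
    (Metric.ball_mem_nhds z (half_pos hpos))
    (him.mono fun w hw => (hs.integrable_mul_inv_sub hw).aestronglyMeasurable)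
    (hs.integrable_mul_inv_sub hz) ?_
    (Eventually.of_forall fun x w hw => ?_) hbound
    (Eventually.of_forall fun x w hw => ?_)).2.differentiableAt
  · refine (hs.continuous.measurable.mul ?_).aestronglyMeasurable
    exact ((by fun_prop : Continuous fun x : ℝ => ((x : ℂ) - z) ^ 2).measurable).inv
  · have h1 := hclose w hw x
    have h2 : ‖(x : ℂ) - z‖ ^ 2 = (x - z.re) ^ 2 + |z.im| ^ 2 := by
      rw [← normSq_eq_norm_sq, normSq_apply, sq_abs]
      simp
      ring
    have h3 : 0 < ‖(x : ℂ) - z‖ := norm_pos_iff.2 (hne z x hz)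
    have h4 : ‖s x‖ ≤ C := (hs.norm_le x).trans (mul_le_of_le_one_right hs.const_nonneg
      (Real.rpow_le_one_of_one_le_of_nonpos (by linarith [abs_nonneg x])
        (by linarith [hs.rate_pos])))
    rw [norm_mul, norm_inv, norm_pow, ← h2, div_eq_mul_inv, inv_mul_cancel_left₀ hpos.ne']
    have h5 : (‖(x : ℂ) - w‖ ^ 2)⁻¹ ≤ 4 * (‖(x : ℂ) - z‖ ^ 2)⁻¹ := by
      rw [← div_eq_mul_inv, ← inv_div]
      refine inv_anti₀ (by positivity) ?_
      nlinarith
    calc ‖s x‖ * (‖(x : ℂ) - w‖ ^ 2)⁻¹ ≤ C * (4 * (‖(x : ℂ) - z‖ ^ 2)⁻¹) := by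
          gcongr
          exact hs.const_nonneg
      _ = _ := by ring
  · have h1 := hne w x (hball w hw)
    have h2 : HasDerivAt (fun w : ℂ => (x : ℂ) - w) (-1) w := (hasDerivAt_id w).const_sub _
    have h3 := (h2.inv h1).const_mul (s x)
    rw [neg_neg, one_div] at h3
    exact h3

theorem HolderDecay.differentiableAt_cauchyPV (hs : HolderDecay s C α β) (L : ℂ) {z : ℂ}
    (hz : z.im ≠ 0) : DifferentiableAt ℂ (fun w => cauchyPV L s w.re w.im) z := by
  have h := (hs.differentiableAt_integral hz).const_add
    (L * (I * ((Real.pi * Real.sign z.im : ℝ) : ℂ)))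
  refine h.congr_of_eventuallyEq ?_
  rcases lt_or_gt_of_ne hz with hlt | hgt
  · filter_upwards [continuous_im.continuousAt.eventually_lt_const hlt] with w hw
    rw [hs.cauchyPV_eq L hw.ne, Real.sign_of_neg hw, Real.sign_of_neg hlt]
  · filter_upwards [continuous_im.continuousAt.eventually_const_lt hgt] with w hw
    rw [hs.cauchyPV_eq L hw.ne', Real.sign_of_pos hw, Real.sign_of_pos hgt]

/-! ### A Liouville theorem for pairs of functions with common radial limits -/

/-- Cauchy's theorem for the upper half-plane, for functions of quadratic decay. -/
theorem integral_eq_zero_of_differentiableOn_upper {G : ℂ → ℂ}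
    (hG : DifferentiableOn ℂ G {ζ | 0 ≤ ζ.im}) (hint : Integrable fun x : ℝ => G x)
    {K R₀ : ℝ} (hbound : ∀ ζ : ℂ, 0 ≤ ζ.im → R₀ ≤ ‖ζ‖ → ‖G ζ‖ ≤ K / ‖ζ‖ ^ 2) :
    ∫ x : ℝ, G x = 0 := by
  have hlim : Tendsto (fun R : ℝ => ∫ x in (-R)..R, G x) atTop (𝓝 (∫ x : ℝ, G x)) :=
    intervalIntegral_tendsto_integral hint tendsto_neg_atTop_atBot tendsto_id
  refine tendsto_nhds_unique hlim ?_
  -- On a rectangle of width `2R` and height `R`, the three sides off the real axis have total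
  -- length `4R`, and the integrand there is at most `|K| / R²`.
  have hK : Tendsto (fun R : ℝ => 4 * |K| * R⁻¹) atTop (𝓝 (4 * |K| * 0)) :=
    tendsto_inv_atTop_zero.const_mul _
  rw [mul_zero] at hK
  refine squeeze_zero_norm' ?_ hK
  filter_upwards [eventually_ge_atTop R₀, eventually_gt_atTop 0] with R hR hR0
  have hrect := integral_boundary_rect_eq_zero_of_differentiableOn G ((-R : ℝ) : ℂ) (R + R * I)
    (hG.mono fun ζ hζ => by
      have := hζ.2
      simp [Set.uIcc_of_le hR0.le] at this
      exact this.1)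
  simp only [ofReal_re, ofReal_im, add_re, add_im, mul_re, mul_im, I_re, I_im, mul_zero, mul_one,
    sub_zero, add_zero, zero_add, ofReal_zero, zero_mul] at hrect
  have hb : ∀ ζ : ℂ, 0 ≤ ζ.im → R ≤ ‖ζ‖ → ‖G ζ‖ ≤ |K| / R ^ 2 := fun ζ h0 h1 =>
    (hbound ζ h0 (hR.trans h1)).trans (by gcongr; exact le_abs_self K)
  have htop : ‖∫ x in (-R)..R, G (x + R * I)‖ ≤ |K| / R ^ 2 * |R - -R| := by
    refine intervalIntegral.norm_integral_le_of_norm_le_const fun x _ => hb _ (by simp [hR0.le]) ?_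
    have := abs_im_le_norm ((x : ℂ) + R * I)
    simp only [add_im, ofReal_im, mul_im, ofReal_re, I_im, I_re, mul_one, mul_zero, add_zero,
      zero_add] at this
    exact (le_abs_self R).trans this
  have hside : ∀ a : ℝ, |a| = R → ‖∫ y in (0 : ℝ)..R, G (a + y * I)‖ ≤ |K| / R ^ 2 * |R - 0| := by
    intro a ha
    refine intervalIntegral.norm_integral_le_of_norm_le_const fun y hy => hb _ ?_ ?_
    · rw [Set.uIoc_of_le hR0.le] at hy
      simpa using hy.1.le
    · have := abs_re_le_norm ((a : ℂ) + y * I)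
      simp only [add_re, ofReal_re, mul_re, ofReal_im, I_re, I_im, mul_zero, mul_one, add_zero,
        sub_self] at this
      rwa [ha] at this
  have h1 := hside R (abs_of_pos hR0)
  have h2 := hside (-R) (by rw [abs_neg, abs_of_pos hR0])
  have heq : ∫ x in (-R)..R, G x = (∫ x in (-R)..R, G (x + R * I)) -
      I * (∫ y in (0 : ℝ)..R, G (R + y * I)) + I * ∫ y in (0 : ℝ)..R, G ((-R : ℝ) + y * I) := by
    simp only [smul_eq_mul] at hrect
    linear_combination hrect
  rw [heq]
  refine (norm_add_le _ _).trans ((add_le_add_left (norm_sub_le _ _) _).trans ?_)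
  rw [norm_mul, norm_mul, norm_I, one_mul, one_mul]
  rw [sub_neg_eq_add, abs_of_pos (add_pos hR0 hR0)] at htop
  rw [sub_zero, abs_of_pos hR0] at h1 h2
  have e : 4 * |K| * R⁻¹ = |K| / R ^ 2 * (R + R) + |K| / R ^ 2 * R + |K| / R ^ 2 * R := by
    field_simp
    ring
  rw [e]
  exact add_le_add (add_le_add htop h1) h2

/-- The difference of the Cauchy kernels at `z` and `w`. -/
noncomputable def kernelDiff (z w ζ : ℂ) : ℂ := (ζ - z)⁻¹ - (ζ - w)⁻¹

theorem ofReal_sub_ne_zero {z : ℂ} (hz : z.im ≠ 0) (x : ℝ) : (x : ℂ) - z ≠ 0 := fun h => hz (by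
  have := congrArg im h
  simpa using this)

theorem kernelDiff_eq {z w ζ : ℂ} (hz : ζ - z ≠ 0) (hw : ζ - w ≠ 0) :
    kernelDiff z w ζ = (z - w) * ((ζ - z) * (ζ - w))⁻¹ := by
  rw [kernelDiff]
  field_simp
  ring

/-- A single Cauchy kernel is not integrable at infinity. The difference decays quadratically, so it
can be paired with functions that are merely bounded. -/
theorem norm_kernelDiff_le {z w ζ : ℂ} (hz : 2 * ‖z‖ < ‖ζ‖) (hw : 2 * ‖w‖ < ‖ζ‖) :
    ‖kernelDiff z w ζ‖ ≤ 4 * ‖z - w‖ / ‖ζ‖ ^ 2 := by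
  have hpos : 0 < ‖ζ‖ := by linarith [norm_nonneg z]
  have h1 : ‖ζ‖ / 2 ≤ ‖ζ - z‖ := by linarith [norm_sub_norm_le ζ z]
  have h2 : ‖ζ‖ / 2 ≤ ‖ζ - w‖ := by linarith [norm_sub_norm_le ζ w]
  have h3 : ζ - z ≠ 0 := norm_pos_iff.1 (by linarith)
  have h4 : ζ - w ≠ 0 := norm_pos_iff.1 (by linarith)
  rw [kernelDiff_eq h3 h4, norm_mul, norm_inv, norm_mul, ← div_eq_mul_inv]
  calc ‖z - w‖ / (‖ζ - z‖ * ‖ζ - w‖) ≤ ‖z - w‖ / (‖ζ‖ / 2 * (‖ζ‖ / 2)) := by gcongr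
    _ = _ := by field_simp; norm_num

theorem continuous_kernelDiff {z w : ℂ} (hz : z.im ≠ 0) (hw : w.im ≠ 0) :
    Continuous fun x : ℝ => kernelDiff z w x :=
  (Continuous.inv₀ (by fun_prop) (ofReal_sub_ne_zero hz)).sub
    (Continuous.inv₀ (by fun_prop) (ofReal_sub_ne_zero hw))

theorem integrable_kernelDiff {z w : ℂ} (hz : z.im ≠ 0) (hw : w.im ≠ 0) :
    Integrable fun x : ℝ => kernelDiff z w x := by
  have hnorm : ∀ (z : ℂ), z.im ≠ 0 → Integrable fun x : ℝ => ‖((x : ℂ) - z)⁻¹‖ ^ 2 := by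
    intro z hz
    refine (((integrable_poissonKernel z.im).comp_sub_right z.re).const_mul z.im⁻¹).congr
      (Eventually.of_forall fun x => ?_)
    have h2 : ‖(x : ℂ) - z‖ ^ 2 = (x - z.re) ^ 2 + z.im ^ 2 := by
      rw [← normSq_eq_norm_sq, normSq_apply]
      simp
      ring
    simp only [norm_inv, inv_pow]
    rw [h2, div_eq_mul_inv, inv_mul_cancel_left₀ hz]
  refine (((hnorm z hz).add (hnorm w hw)).const_mul ‖z - w‖).mono'
    (continuous_kernelDiff hz hw).aestronglyMeasurable (Eventually.of_forall fun x => ?_)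
  rw [kernelDiff_eq (ofReal_sub_ne_zero hz x) (ofReal_sub_ne_zero hw x), norm_mul, mul_inv,
    norm_mul]
  refine mul_le_mul_of_nonneg_left ?_ (norm_nonneg _)
  simp only [Pi.add_apply]
  nlinarith [sq_nonneg (‖((x : ℂ) - z)⁻¹‖ - ‖((x : ℂ) - w)⁻¹‖), norm_nonneg ((x : ℂ) - z)⁻¹,
    norm_nonneg ((x : ℂ) - w)⁻¹]

/-- The principal values for poles above and below the line are `iπ` and `-iπ`. -/
theorem integral_kernelDiff {z w : ℂ} (hz : 0 < z.im) (hw : w.im < 0) :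
    ∫ x : ℝ, kernelDiff z w x = 2 * Real.pi * I := by
  have hpv : ∀ (z : ℂ), z.im ≠ 0 → Tendsto (fun R : ℝ => ∫ x in (-R)..R, ((x : ℂ) - z)⁻¹) atTop
      (𝓝 (I * ((Real.pi * Real.sign z.im : ℝ) : ℂ))) := by
    intro z hz
    have h := hasPV_inv_sub z.re z.im
    rw [re_add_im] at h
    -- With `ε = 1/R < |Im z|` the inner truncation removes nothing, leaving the interval from `-R`
    -- to `R`.
    have hpair : Tendsto (fun R : ℝ => (R⁻¹, R)) atTop (𝓝[>] (0 : ℝ) ×ˢ atTop) :=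
      tendsto_inv_atTop_nhdsGT_zero.prodMk tendsto_id
    refine (h.comp hpair).congr' ?_
    filter_upwards [eventually_gt_atTop |z.im|⁻¹] with R hR
    have hR0 : 0 < R := (inv_pos.2 (abs_pos.2 hz)).trans hR
    rw [intervalIntegral.integral_of_le (by linarith), integral_Ioc_eq_integral_Ioo,
      Function.comp_apply, truncatedIntegral]
    congr 2
    ext x
    simp only [Set.mem_ofPred_eq, Set.mem_Ioo, abs_lt, and_iff_right_iff_imp]
    intro _
    refine (inv_lt_of_inv_lt₀ (abs_pos.2 hz) hR).trans_le ?_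
    have := abs_le_norm_sub z.re z.im x
    rwa [re_add_im] at this
  have h1 := (hpv z hz.ne').sub (hpv w hw.ne)
  rw [Real.sign_of_pos hz, Real.sign_of_neg hw] at h1
  have h2 : Tendsto (fun R : ℝ => ∫ x in (-R)..R, kernelDiff z w x) atTop
      (𝓝 (∫ x : ℝ, kernelDiff z w x)) :=
    intervalIntegral_tendsto_integral (integrable_kernelDiff hz.ne' hw.ne)
      tendsto_neg_atTop_atBot tendsto_id
  have h3 : ∀ z : ℂ, z.im ≠ 0 → Continuous fun x : ℝ => ((x : ℂ) - z)⁻¹ := fun z hz =>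
    Continuous.inv₀ (by fun_prop) (ofReal_sub_ne_zero hz)
  refine (tendsto_nhds_unique h2 (h1.congr fun R => ?_)).trans ?_
  · exact (intervalIntegral.integral_sub ((h3 z hz.ne').intervalIntegrable _ _)
      ((h3 w hw.ne).intervalIntegrable _ _)).symm
  · push_cast
    ring

/-- Cauchy's formula for bounded analytic functions in the closed upper half-plane. -/
theorem integral_mul_kernelDiff_of_continuousOn {h : ℂ → ℂ} {M : ℝ} {z w : ℂ}
    (hh : DifferentiableOn ℂ h {ζ | 0 ≤ ζ.im}) (hM : ∀ ζ : ℂ, 0 ≤ ζ.im → ‖h ζ‖ ≤ M)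
    (hz : 0 < z.im) (hw : w.im < 0) :
    ∫ x : ℝ, h x * kernelDiff z w x = 2 * Real.pi * I * h z := by
  have hcont : Continuous fun x : ℝ => h x :=
    hh.continuousOn.comp_continuous continuous_ofReal fun x => by simp
  have hk := integrable_kernelDiff hz.ne' hw.ne
  have hprod : Integrable fun x : ℝ => h x * kernelDiff z w x :=
    hk.bdd_mul hcont.aestronglyMeasurable (Eventually.of_forall fun x => hM x (by simp))
  have hM0 : 0 ≤ M := (norm_nonneg _).trans (hM z hz.le)
  -- `G` is `(h ζ - h z) * kernelDiff z w ζ` with the singularity at `z` removed; the other pole `w`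
  -- lies below the line.
  set G : ℂ → ℂ := fun ζ => dslope h z ζ * ((z - w) * (ζ - w)⁻¹) with hGdef
  have hG : ∀ ζ : ℂ, ζ ≠ z → ζ - w ≠ 0 → G ζ = (h ζ - h z) * kernelDiff z w ζ := by
    intro ζ h1 h2
    have h3 := sub_ne_zero.2 h1
    rw [hGdef, kernelDiff_eq h3 h2]
    simp only
    rw [dslope_of_ne _ h1, slope_def_field]
    field_simp
  have hGx : ∀ x : ℝ, G x = h x * kernelDiff z w x - h z * kernelDiff z w x := fun x => by
    rw [hG x (sub_ne_zero.1 (ofReal_sub_ne_zero hz.ne' x)) (ofReal_sub_ne_zero hw.ne x)]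
    ring
  have hzero : ∫ x : ℝ, G x = 0 := by
    refine integral_eq_zero_of_differentiableOn_upper (K := 2 * M * (4 * ‖z - w‖))
      (R₀ := 2 * ‖z‖ + 2 * ‖w‖ + 1) ?_ ?_ ?_
    · have hnhds : {ζ : ℂ | 0 ≤ ζ.im} ∈ 𝓝 z :=
        mem_of_superset ((isOpen_lt continuous_const continuous_im).mem_nhds hz)
          fun ζ (hζ : 0 < ζ.im) => hζ.le
      refine ((differentiableOn_dslope hnhds).2 hh).mul (DifferentiableOn.const_mul ?_ _)
      refine DifferentiableOn.inv (by fun_prop) fun ζ (hζ : 0 ≤ ζ.im) h0 => ?_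
      have := congrArg im h0
      simp only [sub_im, zero_im] at this
      linarith
    · simp_rw [hGx]
      exact hprod.sub (hk.const_mul _)
    · intro ζ h0 hζ
      have h1 : 2 * ‖z‖ < ‖ζ‖ := by linarith [norm_nonneg w]
      have h2 : 2 * ‖w‖ < ‖ζ‖ := by linarith [norm_nonneg z]
      have h3 : ζ ≠ z := by rintro rfl; linarith [norm_nonneg ζ]
      have h4 : ζ - w ≠ 0 := sub_ne_zero.2 (by rintro rfl; linarith [norm_nonneg ζ])
      rw [hG ζ h3 h4, norm_mul, mul_div_assoc]
      refine mul_le_mul ?_ (norm_kernelDiff_le h1 h2) (norm_nonneg _) (by linarith)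
      linarith [norm_sub_le (h ζ) (h z), hM ζ h0, hM z hz.le]
  simp_rw [hGx] at hzero
  rw [integral_sub hprod (hk.const_mul _), integral_const_mul, integral_kernelDiff hz hw,
    sub_eq_zero] at hzero
  rw [hzero]
  ring

/-- Cauchy's formula for a bounded analytic function in the upper half-plane, in terms of its
radial limits. -/
theorem integral_radialLimit_mul_kernelDiff {h : ℂ → ℂ} {hp : ℝ → ℂ} {M : ℝ} {z w : ℂ}
    (hh : DifferentiableOn ℂ h {ζ | 0 < ζ.im}) (hM : ∀ ζ : ℂ, 0 < ζ.im → ‖h ζ‖ ≤ M)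
    (hlim : ∀ ω : ℝ, Tendsto (fun y : ℝ => h (ω + y * I)) (𝓝[>] 0) (𝓝 (hp ω)))
    (hz : 0 < z.im) (hw : w.im < 0) :
    ∫ x : ℝ, hp x * kernelDiff z w x = 2 * Real.pi * I * h z := by
  have hk := integrable_kernelDiff hz.ne' hw.ne
  have hpos : ∀ᶠ ε in 𝓝[>] (0 : ℝ), 0 < ε := self_mem_nhdsWithin
  -- Shifting up by `ε` makes the function analytic on the closed half-plane. The bound `M` then
  -- permits `ε → 0` under the integral, using only pointwise radial limits.
  have hshift : ∀ ε : ℝ, 0 < ε →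
      DifferentiableOn ℂ (fun ζ => h (ζ + ε * I)) {ζ | 0 ≤ ζ.im} := fun ε hε =>
    hh.comp (by fun_prop) fun ζ (hζ : 0 ≤ ζ.im) => by
      simp only [Set.mem_ofPred_eq, add_im, mul_im, ofReal_re, I_im, ofReal_im, I_re]
      linarith
  have hbd : ∀ ε : ℝ, 0 < ε → ∀ ζ : ℂ, 0 ≤ ζ.im → ‖h (ζ + ε * I)‖ ≤ M := fun ε hε ζ hζ =>
    hM _ (by
      simp only [add_im, mul_im, ofReal_re, I_im, ofReal_im, I_re]
      linarith)
  have hleft : Tendsto (fun ε : ℝ => ∫ x : ℝ, h (x + ε * I) * kernelDiff z w x) (𝓝[>] 0)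
      (𝓝 (∫ x : ℝ, hp x * kernelDiff z w x)) := by
    refine tendsto_integral_filter_of_dominated_convergence (fun x => M * ‖kernelDiff z w x‖)
      ?_ ?_ (hk.norm.const_mul M) (Eventually.of_forall fun x => (hlim x).mul_const _)
    · filter_upwards [hpos] with ε hε
      refine Continuous.aestronglyMeasurable
        (Continuous.mul ?_ (continuous_kernelDiff hz.ne' hw.ne))
      exact (hshift ε hε).continuousOn.comp_continuous continuous_ofReal fun x => by simp
    · filter_upwards [hpos] with ε hε
      refine Eventually.of_forall fun x => ?_
      rw [norm_mul]
      gcongr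
      exact hbd ε hε x (by simp)
  have hright : Tendsto (fun ε : ℝ => 2 * Real.pi * I * h (z + ε * I)) (𝓝[>] 0)
      (𝓝 (2 * Real.pi * I * h z)) := by
    have h1 : ContinuousAt h z :=
      (hh.differentiableAt ((isOpen_lt continuous_const continuous_im).mem_nhds hz)).continuousAt
    have h2 : Tendsto (fun ε : ℝ => z + ε * I) (𝓝[>] 0) (𝓝 z) := by
      have := (by fun_prop : Continuous fun ε : ℝ => z + ε * I).tendsto 0
      simp only [ofReal_zero, zero_mul, add_zero] at this
      exact this.mono_left nhdsWithin_le_nhds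
    exact (h1.tendsto.comp h2).const_mul _
  refine tendsto_nhds_unique hleft (hright.congr' ?_)
  filter_upwards [hpos] with ε hε
  exact (integral_mul_kernelDiff_of_continuousOn (hshift ε hε) (hbd ε hε) hz hw).symm

/-- Bounded analytic functions in the two half-planes with the same radial limits are constant. -/
theorem eq_of_common_radialLimits {h k : ℂ → ℂ} {f : ℝ → ℂ} {M N : ℝ}
    (hh : DifferentiableOn ℂ h {ζ | 0 < ζ.im}) (hM : ∀ ζ : ℂ, 0 < ζ.im → ‖h ζ‖ ≤ M)
    (hlim : ∀ ω : ℝ, Tendsto (fun y : ℝ => h (ω + y * I)) (𝓝[>] 0) (𝓝 (f ω)))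
    (hk : DifferentiableOn ℂ k {ζ | ζ.im < 0}) (hN : ∀ ζ : ℂ, ζ.im < 0 → ‖k ζ‖ ≤ N)
    (klim : ∀ ω : ℝ, Tendsto (fun y : ℝ => k (ω + y * I)) (𝓝[<] 0) (𝓝 (f ω)))
    {z w : ℂ} (hz : 0 < z.im) (hw : w.im < 0) : h z = f 0 ∧ k w = f 0 := by
  have hneg : Tendsto (fun y : ℝ => -y) (𝓝[>] 0) (𝓝[<] 0) := by
    have := tendsto_neg_nhdsGT (a := (0 : ℝ))
    rwa [neg_zero] at this
  -- Both values are `(2πi)⁻¹` times the same integral of `f`. For `k` the reflection `ζ ↦ -ζ`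
  -- exchanges the half-planes and turns the pair `(z, w)` into `(-w, -z)`.
  have key : ∀ z w : ℂ, 0 < z.im → w.im < 0 → h z = k w := by
    intro z w hz hw
    have h1 := integral_radialLimit_mul_kernelDiff hh hM hlim hz hw
    have h2 := integral_radialLimit_mul_kernelDiff (h := fun ζ => k (-ζ)) (hp := fun x => f (-x))
      (M := N) (z := -w) (w := -z)
      (hk.comp (by fun_prop) fun ζ (hζ : 0 < ζ.im) => by simpa using hζ)
      (fun ζ hζ => hN _ (by simpa using hζ))
      (fun ω => ((klim (-ω)).comp hneg).congr fun y => by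
        simp only [Function.comp_apply]
        congr 1
        push_cast
        ring)
      (by simpa using hw) (by simpa using hz)
    have h3 : ∀ x : ℝ, kernelDiff (-w) (-z) x = kernelDiff z w ((-x : ℝ) : ℂ) := by
      intro x
      have e : ∀ u : ℂ, ((x : ℂ) - -u)⁻¹ = -(((-x : ℝ) : ℂ) - u)⁻¹ := fun u => by
        rw [← inv_neg]
        congr 1
        push_cast
        ring
      rw [kernelDiff, kernelDiff, e, e]
      ring
    simp_rw [h3] at h2
    rw [integral_neg_eq_self (fun x : ℝ => f x * kernelDiff z w x), h1] at h2
    simpa [Real.pi_ne_zero] using h2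
  have hcst : ∀ z : ℂ, 0 < z.im → h z = f 0 := by
    intro z hz
    refine tendsto_nhds_unique (tendsto_const_nhds.congr' ?_) (klim 0)
    filter_upwards [self_mem_nhdsWithin] with y hy
    exact key z _ hz (by simpa using hy)
  exact ⟨hcst z hz, (key z w hz hw).symm.trans (hcst z hz)⟩

end WienerHopf

namespace WienerHopf

/-! ### Regularity of the logarithm -/

/-- Since `|exp w - 1 - w| ≤ |w|² ≤ |w| / 2`. This quantitative local injectivity of `exp` carries
estimates on `g` back to its logarithm. -/
theorem norm_le_two_mul_norm_exp_sub_one {w : ℂ} (hw : ‖w‖ ≤ 1 / 2) :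
    ‖w‖ ≤ 2 * ‖exp w - 1‖ := by
  have h1 := norm_exp_sub_one_sub_id_le (hw.trans (by norm_num))
  have h2 := norm_sub_norm_le w (exp w - 1)
  rw [norm_sub_rev w (exp w - 1)] at h2
  nlinarith [norm_nonneg w]

/-- The difference of two logarithms takes values in the discrete set `2πiℤ`, so it is locally
constant on a connected line. -/
theorem sub_eq_sub_of_exp_eq {u v : ℝ → ℂ} (hu : Continuous u) (hv : Continuous v)
    (h : ∀ x, exp (u x) = exp (v x)) (x y : ℝ) : u x - v x = u y - v y := by
  have hc : IsLocallyConstant fun x => u x - v x := by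
    rw [IsLocallyConstant.iff_eventually_eq]
    intro x
    have hcont : Continuous fun y => (u y - v y) - (u x - v x) := by fun_prop
    have hev : ∀ᶠ y in 𝓝 x, ‖(u y - v y) - (u x - v x)‖ < 1 / 2 :=
      hcont.norm.continuousAt.eventually_lt_const (by simp)
    filter_upwards [hev] with y hy
    have h1 := norm_le_two_mul_norm_exp_sub_one hy.le
    have h2 : exp ((u y - v y) - (u x - v x)) = 1 := by
      simp [exp_sub, h, exp_ne_zero]
    rw [h2, sub_self, norm_zero, mul_zero] at h1
    exact sub_eq_zero.1 (norm_le_zero_iff.1 h1)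
  exact hc.apply_eq_of_preconnectedSpace x y

/-- Here index zero enters: the limits at the two ends coincide. With different limits the principal
value at infinity would diverge logarithmically. -/
theorem IsLogBranch.exists_tendsto_cocompact {g lng : ℝ → ℂ} (hindex : HasIndex g 0)
    (hlng : IsLogBranch g lng) : ∃ L : ℂ, Tendsto lng (cocompact ℝ) (𝓝 L) := by
  obtain ⟨s, hs, hexp, a, b, ha, hb, hab⟩ := hindex
  have hab : b = a := by simpa [sub_eq_zero] using hab
  subst hab
  have hd : ∀ x, s x + (lng 0 - s 0) = lng x := fun x => by
    rw [← sub_eq_sub_of_exp_eq hlng.continuous hs (fun x => by rw [hlng.exp_eq, hexp]) x 0]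
    ring
  refine ⟨b + (lng 0 - s 0), ?_⟩
  rw [cocompact_eq_atBot_atTop, tendsto_sup]
  exact ⟨(ha.add_const _).congr hd, (hb.add_const _).congr hd⟩

theorem exists_norm_le_of_tendsto_cocompact {u : ℝ → ℂ} (hu : Continuous u)
    (h : Tendsto u (cocompact ℝ) (𝓝 0)) : ∃ M : ℝ, 0 ≤ M ∧ ∀ x, ‖u x‖ ≤ M := by
  have h1 : ∀ᶠ x in cocompact ℝ, ‖u x‖ < 1 := by
    have := h.norm
    rw [norm_zero] at this
    exact this.eventually_lt_const one_pos
  obtain ⟨K, hK, hsub⟩ := mem_cocompact.1 h1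
  obtain ⟨M, hM⟩ := hK.exists_bound_of_continuousOn hu.continuousOn
  refine ⟨max 1 M, by positivity, fun x => ?_⟩
  by_cases hx : x ∈ K
  · exact (hM x hx).trans (le_max_right _ _)
  · exact (hsub hx : ‖u x‖ < 1).le.trans (le_max_left _ _)

theorem exists_norm_le_rpow_of_tendsto {u : ℝ → ℂ} {L : ℂ} {K β M : ℝ}
    (hlim : Tendsto u (cocompact ℝ) (𝓝 0)) (hM : ∀ x, ‖u x‖ ≤ M) (hβ : 0 < β)
    (hdecay : ∀ x : ℝ, 1 ≤ |x| → ‖exp (L + u x) - exp L‖ ≤ K * |1 / x| ^ β) :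
    ∃ C : ℝ, 0 ≤ C ∧ ∀ x : ℝ, ‖u x‖ ≤ C * (1 + |x|) ^ (-β) := by
  have h1 : ∀ᶠ x in cocompact ℝ, ‖u x‖ < 1 / 2 := by
    have := hlim.norm
    rw [norm_zero] at this
    exact this.eventually_lt_const (by norm_num)
  obtain ⟨S, hS, hsub⟩ := mem_cocompact.1 h1
  obtain ⟨X, hX⟩ := hS.exists_bound_of_continuousOn (f := fun x : ℝ => x) continuousOn_id
  have hM0 : 0 ≤ M := (norm_nonneg _).trans (hM 0)
  set X' := max X 1
  have hX' : 1 ≤ X' := le_max_right _ _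
  set E := ‖exp (-L)‖
  have hE : 0 ≤ E := norm_nonneg _
  -- The first term serves `|x| ≤ X'`, where `u` is only known to be bounded. The second serves
  -- large `|x|`, where `u` is small enough to invert `exp`; `2 ^ β` comes from `1/|x| ≤ 2/(1 +
  -- |x|)`.
  refine ⟨M * (1 + X') ^ β + 2 * (E * (|K| * 2 ^ β)), by positivity, fun x => ?_⟩
  have hp : 0 < (1 + |x|) ^ (-β) := by positivity
  rw [add_mul]
  rcases le_or_gt |x| X' with hx | hx
  · have h2 : 1 ≤ (1 + X') ^ β * (1 + |x|) ^ (-β) := by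
      rw [Real.rpow_neg (by positivity), ← div_eq_mul_inv, one_le_div (by positivity)]
      gcongr
    have h3 : 0 ≤ 2 * (E * (|K| * 2 ^ β)) * (1 + |x|) ^ (-β) := by positivity
    rw [mul_assoc M]
    nlinarith [hM x, mul_le_mul_of_nonneg_left h2 hM0]
  · have hxS : x ∉ S := fun h => by
      have := hX x h
      rw [Real.norm_eq_abs] at this
      linarith [le_max_left X 1]
    have h2 := norm_le_two_mul_norm_exp_sub_one (hsub hxS : ‖u x‖ < 1 / 2).le
    have h3 : exp (u x) - 1 = exp (-L) * (exp (L + u x) - exp L) := by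
      rw [mul_sub, ← exp_add, ← exp_add]
      simp
    have hx1 : 1 ≤ |x| := hX'.trans hx.le
    have h4 : |1 / x| ^ β ≤ 2 ^ β * (1 + |x|) ^ (-β) := by
      rw [Real.rpow_neg (by positivity), ← Real.inv_rpow (by positivity),
        ← Real.mul_rpow (by positivity) (by positivity), abs_div, abs_one]
      refine Real.rpow_le_rpow (by positivity) ?_ hβ.le
      rw [← div_eq_mul_inv, div_le_div_iff₀ (by linarith) (by linarith)]
      linarith
    have h5 : ‖exp (L + u x) - exp L‖ ≤ |K| * (2 ^ β * (1 + |x|) ^ (-β)) :=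
      (hdecay x hx1).trans (mul_le_mul (le_abs_self K) h4 (by positivity) (abs_nonneg K))
    rw [h3, norm_mul] at h2
    have h6 : 0 ≤ M * (1 + X') ^ β * (1 + |x|) ^ (-β) := by positivity
    have h7 := mul_le_mul_of_nonneg_left h5 hE
    calc ‖u x‖ ≤ 2 * (E * (|K| * (2 ^ β * (1 + |x|) ^ (-β)))) := by linarith
      _ = 2 * (E * (|K| * 2 ^ β)) * (1 + |x|) ^ (-β) := by ring
      _ ≤ _ := by linarith

theorem exists_norm_sub_le_rpow_of_uniformContinuous {u : ℝ → ℂ} {K α M : ℝ}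
    (hu : UniformContinuous u) (hM : ∀ x, ‖u x‖ ≤ M) (hα : 0 < α)
    (hK : ∀ x y : ℝ, ‖exp (u x) - exp (u y)‖ ≤ K * |x - y| ^ α) :
    ∃ C : ℝ, 0 ≤ C ∧ ∀ x y : ℝ, ‖u x - u y‖ ≤ C * |x - y| ^ α := by
  obtain ⟨δ, hδ, hclose⟩ := Metric.uniformContinuous_iff.1 hu (1 / 2) (by norm_num)
  have hM0 : 0 ≤ M := (norm_nonneg _).trans (hM 0)
  -- Points at distance at least `δ` are handled by the trivial bound `2M`, closer ones by inverting
  -- `exp`, where `Real.exp M` bounds `exp (-u y)`.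
  refine ⟨2 * M * (δ ^ α)⁻¹ + 2 * (Real.exp M * |K|), by positivity, fun x y => ?_⟩
  have hp : 0 ≤ |x - y| ^ α := by positivity
  rw [add_mul]
  rcases lt_or_ge |x - y| δ with h | h
  · have h1 := hclose (a := x) (b := y) (by rwa [Real.dist_eq])
    rw [dist_eq_norm] at h1
    have h2 := norm_le_two_mul_norm_exp_sub_one h1.le
    have h3 : exp (u x - u y) - 1 = exp (-u y) * (exp (u x) - exp (u y)) := by
      rw [mul_sub, ← exp_add, ← exp_add, sub_eq_neg_add (u x) (u y)]
      simp
    have h4 : ‖exp (-u y)‖ ≤ Real.exp M := by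
      rw [norm_exp]
      refine Real.exp_le_exp.2 ((re_le_norm _).trans ?_)
      rw [norm_neg]
      exact hM y
    rw [h3, norm_mul] at h2
    have h5 : ‖exp (u x) - exp (u y)‖ ≤ |K| * |x - y| ^ α :=
      (hK x y).trans (mul_le_mul_of_nonneg_right (le_abs_self K) hp)
    have h6 := mul_le_mul h4 h5 (norm_nonneg _) (Real.exp_pos M).le
    have h7 : 0 ≤ 2 * M * (δ ^ α)⁻¹ * |x - y| ^ α := by positivity
    linarith
  · have h1 : ‖u x - u y‖ ≤ 2 * M := by
      linarith [norm_sub_le (u x) (u y), hM x, hM y]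
    have h2 : 1 ≤ (δ ^ α)⁻¹ * |x - y| ^ α := by
      rw [← div_eq_inv_mul, one_le_div (by positivity)]
      gcongr
    have h3 : 0 ≤ 2 * (Real.exp M * |K|) * |x - y| ^ α := by positivity
    rw [mul_assoc (2 * M)]
    nlinarith

theorem IsLogBranch.exists_holderDecay {g lng : ℝ → ℂ} (hHolder : HolderOnExtendedLine g)
    (hindex : HasIndex g 0) (hlng : IsLogBranch g lng) :
    ∃ (L : ℂ) (C α β : ℝ), HolderDecay (fun x => lng x - L) C α β := by
  obtain ⟨⟨C₁, α, hα, hg⟩, Lg, C₂, β, hβ, hinf⟩ := hHolder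
  obtain ⟨L, hL⟩ := hlng.exists_tendsto_cocompact hindex
  have hcont : Continuous fun x => lng x - L := hlng.continuous.sub continuous_const
  have hlim : Tendsto (fun x => lng x - L) (cocompact ℝ) (𝓝 0) := by
    simpa using hL.sub_const L
  obtain ⟨M, hM0, hM⟩ := exists_norm_le_of_tendsto_cocompact hcont hlim
  -- The limit in the Hölder condition at infinity must be identified with `exp L` before the decay
  -- of `g - Lg` says anything about `lng - L`.
  have hLg : Lg = exp L := by
    have h1 : Tendsto g atTop (𝓝 (exp L)) := by
      have := (continuous_exp.tendsto L).comp (hL.mono_left atTop_le_cocompact)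
      exact this.congr hlng.exp_eq
    refine tendsto_nhds_unique ?_ h1
    rw [tendsto_iff_norm_sub_tendsto_zero]
    have h2 : Tendsto (fun x : ℝ => C₂ * |1 / x| ^ β) atTop (𝓝 (C₂ * 0)) := by
      refine Tendsto.const_mul _ ?_
      have h3 : Tendsto (fun x : ℝ => |1 / x|) atTop (𝓝 0) := by
        simpa using (tendsto_inv_atTop_zero (𝕜 := ℝ)).abs
      simpa [Real.zero_rpow hβ.ne'] using h3.rpow_const (p := β) (Or.inr hβ.le)
    rw [mul_zero] at h2
    refine squeeze_zero' (Eventually.of_forall fun x => norm_nonneg _) ?_ h2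
    filter_upwards [eventually_ge_atTop 1] with x hx
    exact hinf x (hx.trans (le_abs_self x))
  have hexp : ∀ x, exp (L + (lng x - L)) = g x := fun x => by
    rw [add_sub_cancel, hlng.exp_eq]
  obtain ⟨A, hA0, hA⟩ := exists_norm_le_rpow_of_tendsto (L := L) (K := C₂) hlim hM hβ
    (fun x hx => by rw [hexp, ← hLg]; exact hinf x hx)
  obtain ⟨B, hB0, hB⟩ := exists_norm_sub_le_rpow_of_uniformContinuous
    (K := ‖exp (-L)‖ * C₁) (hcont.uniformContinuous_of_tendsto_cocompact hlim) hM
    (NNReal.coe_pos.2 hα) (fun x y => by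
      have h1 := hg.dist_le x y
      rw [dist_eq_norm, Real.dist_eq] at h1
      have h2 : exp (lng x - L) - exp (lng y - L) = exp (-L) * (g x - g y) := by
        rw [← hlng.exp_eq, ← hlng.exp_eq, mul_sub, ← exp_add, ← exp_add,
          sub_eq_neg_add (lng x), sub_eq_neg_add (lng y)]
      rw [h2, norm_mul, mul_assoc]
      gcongr)
  refine ⟨L, A + B, α, β, hcont, by positivity, NNReal.coe_pos.2 hα, hβ, fun x y _ => ?_,
    fun x => ?_⟩
  · refine (hB x y).trans ?_
    gcongr
    linarith
  · refine (hA x).trans ?_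
    gcongr
    linarith

end WienerHopf

namespace WienerHopf

/-! ### The factorization -/

theorem HasPV.pvIntegral_eq {f : ℝ → ℂ} {c J : ℂ} (h : HasPV f c J) : pvIntegral f c = J :=
  h.limUnder_eq

theorem plemelj_ofReal (s : ℝ → ℂ) (ω : ℝ) :
    plemelj s ω = -(I / 2 * hilbertTransform s ω) := by
  have h1 : (Real.pi : ℂ) ≠ 0 := ofReal_ne_zero.2 Real.pi_ne_zero
  rw [plemelj, hilbertTransform]
  field_simp
  rw [I_sq]
  ring

section

variable {s u : ℝ → ℂ} {C α β : ℝ} {L : ℂ}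

theorem HolderDecay.hasPV_of_eq (hs : HolderDecay u C α β) (hu : ∀ x, L + u x = s x) (z : ℂ) :
    HasPV (fun x => s x / (x - z)) z (cauchyPV L u z.re z.im) := by
  have h := hs.hasPV L z.re z.im
  simpa only [re_add_im, hu] using h

theorem HolderDecay.plemelj_eq (hs : HolderDecay u C α β) (hu : ∀ x, L + u x = s x) (z : ℂ) :
    plemelj s z = 1 / (2 * Real.pi * I) * cauchyPV L u z.re z.im := by
  rw [plemelj, (hs.hasPV_of_eq hu z).pvIntegral_eq]

theorem HolderDecay.norm_plemelj_le (hs : HolderDecay u C α β) (hu : ∀ x, L + u x = s x) :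
    ∃ M : ℝ, ∀ z : ℂ, ‖plemelj s z‖ ≤ M := by
  obtain ⟨M, hM⟩ := hs.norm_cauchyPV_le L
  refine ⟨‖1 / (2 * Real.pi * I)‖ * M, fun z => ?_⟩
  rw [hs.plemelj_eq hu, norm_mul]
  gcongr
  exact hM _ _

theorem HolderDecay.differentiableAt_plemelj (hs : HolderDecay u C α β)
    (hu : ∀ x, L + u x = s x) {z : ℂ} (hz : z.im ≠ 0) : DifferentiableAt ℂ (plemelj s) z := by
  have h : plemelj s = fun w => 1 / (2 * Real.pi * I) * cauchyPV L u w.re w.im :=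
    funext (hs.plemelj_eq hu)
  rw [h]
  exact (hs.differentiableAt_cauchyPV L hz).const_mul _

theorem HolderDecay.tendsto_plemelj_right (hs : HolderDecay u C α β)
    (hu : ∀ x, L + u x = s x) (ω : ℝ) :
    Tendsto (fun y : ℝ => plemelj s (ω + y * I)) (𝓝[>] 0) (𝓝 (plemelj s ω + s ω / 2)) := by
  have h1 : (Real.pi : ℂ) ≠ 0 := ofReal_ne_zero.2 Real.pi_ne_zero
  have h := (hs.tendsto_cauchyPV_right L ω).const_mul (1 / (2 * Real.pi * I))
  simp_rw [hs.plemelj_eq hu]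
  convert h using 2
  · simp
  · rw [hu, ofReal_re, ofReal_im]
    field_simp [I_ne_zero]

theorem HolderDecay.tendsto_plemelj_left (hs : HolderDecay u C α β)
    (hu : ∀ x, L + u x = s x) (ω : ℝ) :
    Tendsto (fun y : ℝ => plemelj s (ω + y * I)) (𝓝[<] 0) (𝓝 (plemelj s ω - s ω / 2)) := by
  have h1 : (Real.pi : ℂ) ≠ 0 := ofReal_ne_zero.2 Real.pi_ne_zero
  have h := (hs.tendsto_cauchyPV_left L ω).const_mul (1 / (2 * Real.pi * I))
  simp_rw [hs.plemelj_eq hu]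
  convert h using 2
  · simp
  · rw [hu, ofReal_re, ofReal_im]
    field_simp [I_ne_zero]

end

/-- The Plemelj integral of `s` is bounded, analytic off the real line and satisfies the
Sokhotskyi-Plemelj jump relations. -/
structure PlemeljRegular (s : ℝ → ℂ) : Prop where
  bounded : ∃ M : ℝ, ∀ z : ℂ, ‖plemelj s z‖ ≤ M
  differentiableAt : ∀ z : ℂ, z.im ≠ 0 → DifferentiableAt ℂ (plemelj s) z
  tendsto_right : ∀ ω : ℝ,
    Tendsto (fun y : ℝ => plemelj s (ω + y * I)) (𝓝[>] 0) (𝓝 (plemelj s ω + s ω / 2))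
  tendsto_left : ∀ ω : ℝ,
    Tendsto (fun y : ℝ => plemelj s (ω + y * I)) (𝓝[<] 0) (𝓝 (plemelj s ω - s ω / 2))

/-- The factor in the upper half-plane; its inverse is the factor in the lower one. -/
noncomputable def upperFactor (s : ℝ → ℂ) (z : ℂ) : ℂ := exp (plemelj s z - plemelj s 0)

theorem upperFactor_ne_zero (s : ℝ → ℂ) (z : ℂ) : upperFactor s z ≠ 0 := exp_ne_zero _

theorem inv_upperFactor (s : ℝ → ℂ) (z : ℂ) :
    (upperFactor s z)⁻¹ = exp (-(plemelj s z - plemelj s 0)) := (exp_neg _).symm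

theorem upperFactor_ofReal (s : ℝ → ℂ) (ω : ℝ) :
    upperFactor s ω = exp (I / 2 * (hilbertTransform s 0 - hilbertTransform s ω)) := by
  have h := plemelj_ofReal s 0
  rw [ofReal_zero] at h
  rw [upperFactor, plemelj_ofReal, h]
  congr 1
  ring

theorem upperFactor_zero (s : ℝ → ℂ) : upperFactor s 0 = 1 := by simp [upperFactor]

theorem exp_half_mul_exp_half (a : ℂ) : exp (a / 2) * exp (a / 2) = exp a := by
  rw [← exp_add, add_halves]

variable {s : ℝ → ℂ}

theorem PlemeljRegular.norm_upperFactor_le (h : PlemeljRegular s) :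
    ∃ B : ℝ, 0 < B ∧ ∀ z, ‖upperFactor s z‖ ≤ B ∧ ‖(upperFactor s z)⁻¹‖ ≤ B := by
  obtain ⟨M, hM⟩ := h.bounded
  have hb : ∀ z, ‖plemelj s z - plemelj s 0‖ ≤ 2 * M := fun z => by
    linarith [norm_sub_le (plemelj s z) (plemelj s 0), hM z, hM 0]
  refine ⟨Real.exp (2 * M), Real.exp_pos _, fun z => ⟨?_, ?_⟩⟩
  · rw [upperFactor, norm_exp]
    exact Real.exp_le_exp.2 ((re_le_norm _).trans (hb z))
  · rw [inv_upperFactor, norm_exp]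
    exact Real.exp_le_exp.2 ((re_le_norm _).trans ((norm_neg _).trans_le (hb z)))

theorem PlemeljRegular.differentiableAt_upperFactor (h : PlemeljRegular s) {z : ℂ}
    (hz : z.im ≠ 0) : DifferentiableAt ℂ (upperFactor s) z :=
  ((h.differentiableAt z hz).sub_const _).cexp

theorem PlemeljRegular.tendsto_upperFactor_right (h : PlemeljRegular s) (ω : ℝ) :
    Tendsto (fun y : ℝ => upperFactor s (ω + y * I)) (𝓝[>] 0)
      (𝓝 (exp (s ω / 2) * upperFactor s ω)) := by
  have e : exp (s ω / 2) * upperFactor s ω = exp (plemelj s ω + s ω / 2 - plemelj s 0) := by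
    rw [upperFactor, ← exp_add]
    congr 1
    ring
  rw [e]
  exact ((h.tendsto_right ω).sub_const _).cexp

/-- Inversion turns the jump `-s/2` from below into `+s/2`. Both boundary values thus carry the same
factor `exp (s ω / 2)`, the square root of `g`, and the remaining factors are mutually inverse. -/
theorem PlemeljRegular.tendsto_inv_upperFactor_left (h : PlemeljRegular s) (ω : ℝ) :
    Tendsto (fun y : ℝ => (upperFactor s (ω + y * I))⁻¹) (𝓝[<] 0)
      (𝓝 (exp (s ω / 2) * (upperFactor s ω)⁻¹)) := by
  have e : exp (s ω / 2) * (upperFactor s ω)⁻¹ =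
      exp (-(plemelj s ω - s ω / 2 - plemelj s 0)) := by
    rw [inv_upperFactor, ← exp_add]
    congr 1
    ring
  rw [e]
  simp_rw [inv_upperFactor]
  exact ((h.tendsto_left ω).sub_const _).neg.cexp

theorem PlemeljRegular.isSolution (h : PlemeljRegular s) {g : ℝ → ℂ} (hs : IsLogBranch g s)
    {Φ : ℂ → ℂ} {Φp Φm : ℝ → ℂ} (hup : ∀ z : ℂ, 0 < z.im → Φ z = upperFactor s z)
    (hlow : ∀ z : ℂ, z.im < 0 → Φ z = (upperFactor s z)⁻¹)
    (hp : ∀ ω, Φp ω = exp (s ω / 2) * upperFactor s ω)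
    (hm : ∀ ω, Φm ω = exp (s ω / 2) * (upperFactor s ω)⁻¹) : IsSolution g Φ Φp Φm := by
  obtain ⟨B, hB0, hB⟩ := h.norm_upperFactor_le
  have hopen : IsOpen {z : ℂ | z.im ≠ 0} := isOpen_ne_fun continuous_im continuous_const
  refine ⟨?_, ⟨B, fun z hz => ?_⟩, fun ω => ?_, fun ω => ?_, fun ω => ?_,
    ⟨B⁻¹, inv_pos.2 hB0, Or.inl fun z hz => ?_⟩⟩
  · refine DifferentiableOn.analyticOn (fun z hz => ?_) hopen
    refine DifferentiableAt.differentiableWithinAt ?_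
    rcases lt_or_gt_of_ne (show z.im ≠ 0 from hz) with hlt | hgt
    · refine ((h.differentiableAt_upperFactor hz).inv
        (upperFactor_ne_zero s z)).congr_of_eventuallyEq ?_
      filter_upwards [continuous_im.continuousAt.eventually_lt_const hlt] with w hw
      exact hlow w hw
    · refine (h.differentiableAt_upperFactor hz).congr_of_eventuallyEq ?_
      filter_upwards [continuous_im.continuousAt.eventually_const_lt hgt] with w hw
      exact hup w hw
  · rcases lt_or_gt_of_ne hz with hlt | hgt
    · rw [hlow z hlt]
      exact (hB z).2
    · rw [hup z hgt]
      exact (hB z).1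
  · rw [hp]
    refine (h.tendsto_upperFactor_right ω).congr' ?_
    filter_upwards [self_mem_nhdsWithin] with y hy
    exact (hup _ (by simpa using hy)).symm
  · rw [hm]
    refine (h.tendsto_inv_upperFactor_left ω).congr' ?_
    filter_upwards [self_mem_nhdsWithin] with y hy
    exact (hlow _ (by simpa using hy)).symm
  · rw [hp, hm, mul_mul_mul_comm, mul_inv_cancel₀ (upperFactor_ne_zero s _), mul_one,
      exp_half_mul_exp_half, hs.exp_eq]
  · rw [hup z hz]
    have h1 := (hB z).2
    rw [norm_inv] at h1
    exact inv_le_of_inv_le₀ (norm_pos_iff.2 (upperFactor_ne_zero s z)) h1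

theorem IsSolution.upper_limit_ne_zero {g s : ℝ → ℂ} (hs : IsLogBranch g s) {Φ : ℂ → ℂ}
    {Φp Φm : ℝ → ℂ} (hΦ : IsSolution g Φ Φp Φm) (ω : ℝ) : Φp ω ≠ 0 ∧ Φm ω ≠ 0 := by
  rw [← mul_ne_zero_iff, hΦ.factorization, ← hs.exp_eq]
  exact exp_ne_zero _

/-- Every solution is a rescaling of the explicit one. -/
theorem PlemeljRegular.eq_of_isSolution (h : PlemeljRegular s) {g : ℝ → ℂ}
    (hs : IsLogBranch g s) {Φ : ℂ → ℂ} {Φp Φm : ℝ → ℂ} (hΦ : IsSolution g Φ Φp Φm) :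
    (∀ z : ℂ, 0 < z.im → Φ z = Φp 0 * upperFactor s z) ∧
      ∀ z : ℂ, z.im < 0 → Φ z = (Φp 0)⁻¹ * (upperFactor s z)⁻¹ := by
  obtain ⟨B, hB0, hB⟩ := h.norm_upperFactor_le
  obtain ⟨M, hM⟩ := hΦ.bounded
  obtain ⟨δ, hδ, hinv⟩ := hΦ.bounded_inv
  have hne := hΦ.upper_limit_ne_zero hs
  have hUne := upperFactor_ne_zero s
  have hM0 : 0 ≤ M := (norm_nonneg _).trans (hM I (by simp))
  have hopen : IsOpen {z : ℂ | z.im ≠ 0} := isOpen_ne_fun continuous_im continuous_const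
  have hΦd : ∀ z : ℂ, z.im ≠ 0 → DifferentiableAt ℂ Φ z := fun z hz =>
    hΦ.analytic.differentiableOn.differentiableAt (hopen.mem_nhds hz)
  have hUd : ∀ z : ℂ, z.im ≠ 0 → DifferentiableAt ℂ (upperFactor s) z := fun z hz =>
    h.differentiableAt_upperFactor hz
  have hfac : ∀ ω, Φp ω * Φm ω = exp (s ω / 2) * exp (s ω / 2) := fun ω => by
    rw [hΦ.factorization, exp_half_mul_exp_half, hs.exp_eq]
  have hzero : exp (s 0 / 2) * upperFactor s (0 : ℝ) = 1 := by
    rw [hs.zero, zero_div, exp_zero, one_mul, ofReal_zero, upperFactor_zero]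
  -- With `U` for `upperFactor`, a solution is to satisfy `Φ = cU` above and `Φ = (cU)⁻¹` below. If
  -- `Φ` is bounded below in the upper half-plane, `U/Φ` above and `ΦU` below are bounded with
  -- common radial limits, equal to `c⁻¹`.
  rcases hinv with hlb | hlb
  · have hΦne : ∀ z : ℂ, 0 < z.im → Φ z ≠ 0 := fun z hz =>
      norm_pos_iff.1 (hδ.trans_le (hlb z hz))
    have key := fun (z w : ℂ) (hz : 0 < z.im) (hw : w.im < 0) => eq_of_common_radialLimits
      (h := fun z => upperFactor s z * (Φ z)⁻¹) (k := fun z => Φ z * upperFactor s z)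
      (f := fun ω => exp (s ω / 2) * upperFactor s ω * (Φp ω)⁻¹) (M := B * δ⁻¹) (N := M * B)
      (fun ζ (hζ : 0 < ζ.im) =>
        ((hUd ζ hζ.ne').mul ((hΦd ζ hζ.ne').inv (hΦne ζ hζ))).differentiableWithinAt)
      (fun ζ hζ => by
        rw [norm_mul, norm_inv]
        exact mul_le_mul (hB ζ).1 (inv_anti₀ hδ (hlb ζ hζ)) (by positivity) hB0.le)
      (fun ω => (h.tendsto_upperFactor_right ω).mul ((hΦ.upper_limit ω).inv₀ (hne ω).1))
      (fun ζ (hζ : ζ.im < 0) => ((hΦd ζ hζ.ne).mul (hUd ζ hζ.ne)).differentiableWithinAt)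
      (fun ζ hζ => by
        rw [norm_mul]
        exact mul_le_mul (hM ζ hζ.ne) (hB ζ).1 (norm_nonneg _) hM0)
      (fun ω => by
        have h1 := (hΦ.lower_limit ω).mul ((h.tendsto_inv_upperFactor_left ω).inv₀
          (mul_ne_zero (exp_ne_zero _) (inv_ne_zero (hUne _))))
        simp only [inv_inv] at h1
        have e : exp (s ω / 2) * upperFactor s ω * (Φp ω)⁻¹ =
            Φm ω * (exp (s ω / 2) * (upperFactor s ω)⁻¹)⁻¹ := by
          have h2 := (hne ω).1
          have h3 := hUne ω
          have h4 := exp_ne_zero (s ω / 2)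
          field_simp
          linear_combination -hfac ω
        rwa [e])
      (z := z) (w := w) hz hw
    have hf : exp (s 0 / 2) * upperFactor s (0 : ℝ) * (Φp 0)⁻¹ = (Φp 0)⁻¹ := by
      rw [hzero, one_mul]
    refine ⟨fun z hz => ?_, fun w hw => ?_⟩
    · have h1 := (key z (-I) hz (by simp)).1
      rw [hf] at h1
      have h2 := (hne 0).1
      have h3 := hΦne z hz
      field_simp at h1
      linear_combination -h1
    · have h1 := (key I w (by simp) hw).2
      rw [hf] at h1
      exact (eq_mul_inv_iff_mul_eq₀ (hUne w)).2 h1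
  -- Now only the lower half-plane allows division by `Φ`, so the reciprocal quotients `Φ/U` and
  -- `1/(UΦ)` are used; their common value is `c`.
  · have hΦne : ∀ z : ℂ, z.im < 0 → Φ z ≠ 0 := fun z hz =>
      norm_pos_iff.1 (hδ.trans_le (hlb z hz))
    have key := fun (z w : ℂ) (hz : 0 < z.im) (hw : w.im < 0) => eq_of_common_radialLimits
      (h := fun z => Φ z * (upperFactor s z)⁻¹) (k := fun z => (upperFactor s z)⁻¹ * (Φ z)⁻¹)
      (f := fun ω => Φp ω * (exp (s ω / 2) * upperFactor s ω)⁻¹) (M := M * B) (N := B * δ⁻¹)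
      (fun ζ (hζ : 0 < ζ.im) =>
        ((hΦd ζ hζ.ne').mul ((hUd ζ hζ.ne').inv (hUne ζ))).differentiableWithinAt)
      (fun ζ hζ => by
        rw [norm_mul]
        exact mul_le_mul (hM ζ hζ.ne') (hB ζ).2 (norm_nonneg _) hM0)
      (fun ω => (hΦ.upper_limit ω).mul ((h.tendsto_upperFactor_right ω).inv₀
        (mul_ne_zero (exp_ne_zero _) (hUne _))))
      (fun ζ (hζ : ζ.im < 0) =>
        (((hUd ζ hζ.ne).inv (hUne ζ)).mul ((hΦd ζ hζ.ne).inv (hΦne ζ hζ))).differentiableWithinAt)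
      (fun ζ hζ => by
        rw [norm_mul, norm_inv (Φ ζ)]
        exact mul_le_mul (hB ζ).2 (inv_anti₀ hδ (hlb ζ hζ)) (by positivity) hB0.le)
      (fun ω => by
        have h1 := (h.tendsto_inv_upperFactor_left ω).mul ((hΦ.lower_limit ω).inv₀ (hne ω).2)
        have e : Φp ω * (exp (s ω / 2) * upperFactor s ω)⁻¹ =
            exp (s ω / 2) * (upperFactor s ω)⁻¹ * (Φm ω)⁻¹ := by
          have h2 := (hne ω).2
          have h3 := hUne ω
          have h4 := exp_ne_zero (s ω / 2)
          field_simp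
          linear_combination hfac ω
        rwa [e])
      (z := z) (w := w) hz hw
    have hf : Φp 0 * (exp (s 0 / 2) * upperFactor s (0 : ℝ))⁻¹ = Φp 0 := by
      rw [hzero, inv_one, mul_one]
    refine ⟨fun z hz => ?_, fun w hw => ?_⟩
    · have h1 := (key z (-I) hz (by simp)).1
      rw [hf] at h1
      rw [← h1, inv_mul_cancel_right₀ (hUne z)]
    · have h1 := (key I w (by simp) hw).2
      rw [hf] at h1
      rw [← h1, mul_inv, inv_inv, inv_inv, mul_right_comm, mul_inv_cancel₀ (hUne w), one_mul]

theorem IsLogBranch.hasPV_and_plemeljRegular {g lng : ℝ → ℂ} (hHolder : HolderOnExtendedLine g)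
    (hindex : HasIndex g 0) (hlng : IsLogBranch g lng) :
    (∀ z : ℂ, ∃ J : ℂ, HasPV (fun x => lng x / (x - z)) z J) ∧ PlemeljRegular lng := by
  obtain ⟨L, C, α, β, hs⟩ := hlng.exists_holderDecay hHolder hindex
  have hu : ∀ x, L + (lng x - L) = lng x := fun x => add_sub_cancel _ _
  exact ⟨fun z => ⟨_, hs.hasPV_of_eq hu z⟩, hs.norm_plemelj_le hu,
    fun z hz => hs.differentiableAt_plemelj hu hz, hs.tendsto_plemelj_right hu,
    hs.tendsto_plemelj_left hu⟩

end WienerHopf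

theorem mainTheorem6 (g : ℝ → ℂ) (hHolder : WienerHopf.HolderOnExtendedLine g)
    (hindex : WienerHopf.HasIndex g 0) (hg0 : g 0 = 1)
    (lng : ℝ → ℂ) (hlng : WienerHopf.IsLogBranch g lng) :
    -- the Sokhotskyi-Plemelj integral exists at every complex point, real or not
    (∀ z : ℂ, ∃ J : ℂ, WienerHopf.HasPV (fun x => lng x / (x - z)) z J) ∧
    -- existence, uniqueness and explicit form of the normalized solution
    (∀ (Φ : ℂ → ℂ) (Φp Φm : ℝ → ℂ),
      (WienerHopf.IsSolution g Φ Φp Φm ∧ Φp 0 = 1) ↔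
        (∀ z : ℂ, 0 < z.im →
          Φ z = Complex.exp (WienerHopf.plemelj lng z - WienerHopf.plemelj lng 0)) ∧
        (∀ z : ℂ, z.im < 0 →
          Φ z = Complex.exp (-(WienerHopf.plemelj lng z - WienerHopf.plemelj lng 0))) ∧
        (∀ ω : ℝ, Φp ω = Complex.exp (lng ω / 2) * Complex.exp (Complex.I / 2 *
          (WienerHopf.hilbertTransform lng 0 - WienerHopf.hilbertTransform lng ω))) ∧
        (∀ ω : ℝ, Φm ω = Complex.exp (lng ω / 2) * Complex.exp (-(Complex.I / 2 *
          (WienerHopf.hilbertTransform lng 0 - WienerHopf.hilbertTransform lng ω))))) ∧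
    -- without the normalization, solutions are the same up to a scalar multiple
    (∀ (Φ : ℂ → ℂ) (Φp Φm : ℝ → ℂ), WienerHopf.IsSolution g Φ Φp Φm →
      Φp 0 ≠ 0 ∧
        (∀ z : ℂ, 0 < z.im → Φ z =
          Φp 0 * Complex.exp (WienerHopf.plemelj lng z - WienerHopf.plemelj lng 0)) ∧
        (∀ z : ℂ, z.im < 0 → Φ z =
          (Φp 0)⁻¹ * Complex.exp (-(WienerHopf.plemelj lng z - WienerHopf.plemelj lng 0)))) := by
  open WienerHopf in
  obtain ⟨hPV, hreg⟩ := hlng.hasPV_and_plemeljRegular hHolder hindex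
  refine ⟨hPV, fun Φ Φp Φm => ?_, fun Φ Φp Φm hΦ => ?_⟩
  -- The Hilbert transform expressions are `upperFactor` and its inverse at real points, so both
  -- directions can be argued with `upperFactor` alone.
  · simp only [Complex.exp_neg (Complex.I / 2 * _), ← upperFactor_ofReal, ← inv_upperFactor]
    constructor
    · rintro ⟨hΦ, h0⟩
      obtain ⟨hup, hlow⟩ := hreg.eq_of_isSolution hlng hΦ
      simp only [h0, inv_one, one_mul] at hup hlow
      refine ⟨hup, hlow, fun ω => ?_, fun ω => ?_⟩
      -- The boundary functions are forced by the values off the line, since radial limits are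
      -- unique.
      · refine tendsto_nhds_unique (hΦ.upper_limit ω)
          ((hreg.tendsto_upperFactor_right ω).congr' ?_)
        filter_upwards [self_mem_nhdsWithin] with y hy
        exact (hup _ (by simpa using hy)).symm
      · refine tendsto_nhds_unique (hΦ.lower_limit ω)
          ((hreg.tendsto_inv_upperFactor_left ω).congr' ?_)
        filter_upwards [self_mem_nhdsWithin] with y hy
        exact (hlow _ (by simpa using hy)).symm
    · rintro ⟨hup, hlow, hp, hm⟩
      refine ⟨hreg.isSolution hlng hup hlow hp hm, ?_⟩
      rw [hp, hlng.zero, zero_div, Complex.exp_zero, one_mul, Complex.ofReal_zero, upperFactor_zero]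
  · obtain ⟨hup, hlow⟩ := hreg.eq_of_isSolution hlng hΦ
    simp only [inv_upperFactor] at hlow
    exact ⟨(hΦ.upper_limit_ne_zero hlng 0).1, hup, hlow⟩
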